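/- Let $K$ be an algebraically closed field of characteristic zero. For a polynomial map $f$ of the affine plane $\mathbb{A}^2(K)=K^2$, let $\deg(f)$ be the maximum of the degrees of its two components. A polynomial automorphism $f$ of $\mathbb{A}^2$ (a polynomial bijection with polynomial inverse) is called regular if its extension as a rational map $F:\mathbb{P}^2 \dashrightarrow \mathbb{P}^2$ contracts the line at infinity to a point $p_+$ that is not an indeterminacy point of $F$. It is of Hénon type if it is conjugate, in the group of polynomial automorphisms of $\mathbb{A}^2$, to a regular automorphism of degree at least $2$. Let $f$ be a polynomial automorphism of $\mathbb{A}^2$ of Hénon type, and let $\sigma$ be a polynomial automorphism of $\mathbb{A}^2$ such that $\sigma\circ\sigma=\mathrm{id}$ and $\sigma^{-1}\circ f\circ\sigma=f^{-1}$. Let $C\subset\mathbb{A}^2$ be an algebraic curve (the zero set in $K^2$ of a nonconstant polynomial, possibly reducible) all of whose points are fixed by $\sigma$. Then $C$ contains infinitely many periodic points of $f$, that is, infinitely many points $p$ with $f^n(p)=p$ for some integer $n\ge 1$. -/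

import Mathlib

open MvPolynomial

/-- A self-map of the affine plane `K²` is polynomial, with components `P 0`, `P 1`. -/
def HasComponents {K : Type*} [Field K] (g : (Fin 2 → K) → (Fin 2 → K))
    (P : Fin 2 → MvPolynomial (Fin 2) K) : Prop :=
  ∀ p i, g p i = eval p (P i)

theorem HasComponents.comp {K : Type*} [Field K] {g h : (Fin 2 → K) → (Fin 2 → K)}
    {P Q : Fin 2 → MvPolynomial (Fin 2) K} (hg : HasComponents g P) (hh : HasComponents h Q) :
    HasComponents (g ∘ h) (fun i => bind₁ Q (P i)) := by
  intro p i
  have hp : h p = fun j => eval p (Q j) := funext (hh p)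
  have key : eval p (bind₁ Q (P i)) = eval (fun j => eval p (Q j)) (P i) :=
    eval₂Hom_bind₁ (RingHom.id K) p Q (P i)
  rw [key, ← hp]
  exact hg (h p) i

/-- The group of polynomial automorphisms of the affine plane over an infinite field `K`:
bijections of `K²` that are polynomial and have a polynomial inverse, under composition. -/
def PolyAut (K : Type*) [Field K] : Subgroup (Equiv.Perm (Fin 2 → K)) where
  carrier := {g | (∃ P, HasComponents g P) ∧ ∃ Q, HasComponents g.symm Q}
  one_mem' := ⟨⟨X, fun p i => by simp⟩, ⟨X, fun p i => (eval_X (f := p) i).symm⟩⟩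
  mul_mem' := by
    rintro g h ⟨⟨P, hP⟩, ⟨P', hP'⟩⟩ ⟨⟨Q, hQ⟩, ⟨Q', hQ'⟩⟩
    exact ⟨⟨_, hP.comp hQ⟩, ⟨_, hQ'.comp hP'⟩⟩
  inv_mem' := by
    rintro g ⟨h, h'⟩
    exact ⟨h', h⟩

/-- The degree of a polynomial map: the maximum of the degrees of its two components. -/
def mapDegree {K : Type*} [Field K] (P : Fin 2 → MvPolynomial (Fin 2) K) : ℕ :=
  max (P 0).totalDegree (P 1).totalDegree

/-- `Z ^ d * Q (X / Z, Y / Z)` as a polynomial in `X = X 0`, `Y = X 1`, `Z = X 2`,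
for a polynomial `Q` of degree at most `d`. -/
noncomputable def homogenizeTo {K : Type*} [Field K] (d : ℕ) (Q : MvPolynomial (Fin 2) K) :
    MvPolynomial (Fin 3) K :=
  ∑ k ∈ Finset.range (d + 1),
    rename Fin.castSucc (homogeneousComponent k Q) * X 2 ^ (d - k)

/-- The extension to `ℙ²` of the polynomial map with components `P`, in homogeneous coordinates
`[x : y : z]`, where `K²` is the chart `z = 1`. These three forms of degree `d = mapDegree P` have
no common factor (when `P` is not zero), so the map `ℙ² ⇢ ℙ²` is indeterminate exactly at the
points where all three vanish. -/
noncomputable def projExtension {K : Type*} [Field K] (P : Fin 2 → MvPolynomial (Fin 2) K)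
    (q : Fin 3 → K) : Fin 3 → K :=
  ![eval q (homogenizeTo (mapDegree P) (P 0)),
    eval q (homogenizeTo (mapDegree P) (P 1)),
    q 2 ^ mapDegree P]

/-- `f` is a regular automorphism of degree at least `2`: its extension to `ℙ²` contracts the line
at infinity `z = 0` (outside the indeterminacy points, where the scalar `c` is `0`) to a point
`pPlus` that is not an indeterminacy point. -/
def IsRegularAut {K : Type*} [Field K] (f : PolyAut K) : Prop :=
  ∃ P : Fin 2 → MvPolynomial (Fin 2) K,
    HasComponents (f : Equiv.Perm (Fin 2 → K)) P ∧ 2 ≤ mapDegree P ∧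
    ∃ pPlus : Fin 3 → K, pPlus ≠ 0 ∧ projExtension P pPlus ≠ 0 ∧
      ∀ q : Fin 3 → K, q 2 = 0 → ∃ c : K, projExtension P q = c • pPlus

/-- `f` is of Hénon type: it is conjugate, in the group of polynomial automorphisms, to a regular
automorphism of degree at least `2`. -/
def IsHenonType {K : Type*} [Field K] (f : PolyAut K) : Prop :=
  ∃ φ : PolyAut K, IsRegularAut (φ⁻¹ * f * φ)

/-- An algebraic curve in the affine plane: the zero set of a nonconstant polynomial. -/
def IsPlaneCurve {K : Type*} [Field K] (C : Set (Fin 2 → K)) : Prop :=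
  ∃ P : MvPolynomial (Fin 2) K, P.totalDegree ≠ 0 ∧ C = {p | eval p P = 0}

/-!
Let `f` be a regular automorphism of the plane and `σ` an involution with `σ f σ = f⁻¹`; the case of
Hénon type follows by conjugation, and it suffices to treat an irreducible curve `h = 0` of fixed
points of `σ`. If `p` and `f ^ n p` both lie on the curve, then `f ^ (-n) p = σ f ^ n σ p = f ^ n p`,
so `p` is periodic. Hence all intersection points of the curve with its iterates are periodic. The
theorem follows because the total multiplicity of these intersections tends to infinity, whereas
at each single point it stays bounded along the multiples of some period. Automorphisms are studied
through their action on the ring of polynomials, `φ` denoting that of `f`.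

*Behaviour at infinity.* The points of a curve at infinity are described by points with coordinates
in a valued field which tend to infinity (`TendsToInfinity`, `exists_tendsToInfinity`). With these,
the inverse of a regular automorphism is shown to be regular (`IsRegularWith.exists_symm`), and the
curves `φ ^ n h = 0` to meet the line at infinity at the indeterminacy points only, as soon as the
degree of `φ ^ n` exceeds that of `h` (`IsRegularWith.eval_eq_zero_of_lt_pow`). Forward and backward
iterates of the curve are therefore disjoint at infinity, and comparing top forms, no function that
is nonzero on the curve can belong to the ideal `(h, φ ^ n h)` for infinitely many `n`
(`IsRegularWith.exists_forall_notMem_span_pair`).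

*Behaviour at a periodic point.* At a fixed point on the curve, the differential of `σ` is not
trivial (`eq_one_of_jacobianAt_eq_one`), which makes the curve smooth there. Either all iterates are
transverse to the curve, or its tangent direction is an eigenvector of the differential of some
iterate. In the second case, reversibility makes the differential of a further iterate `θ` unipotent
(`mulVec_eq_self_and_det_eq_one`). Modulo a power of the maximal ideal, `θ ^ n h` is then a
polynomial in `n`, not vanishing on the curve for `n = 1`, so that for almost all `n` the
multiplicity is bounded (`eventually_pow_apply_notMem`, `exists_mul_pow_mem_span_pair`).

If there were finitely many periodic points on the curve, a function vanishing at all of them, but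
not on the curve, would have a power in infinitely many of the ideals `(h, φ ^ n h)`, by the
Nullstellensatz.
-/

universe u

variable {K : Type u} [Field K]

/-! ### Top homogeneous components -/

theorem homogeneousComponent_add_mul {σ R : Type*} [CommRing R] {m n : ℕ} {a b : MvPolynomial σ R}
    (ha : a.totalDegree ≤ m) (hb : b.totalDegree ≤ n) :
    homogeneousComponent (m + n) (a * b) = homogeneousComponent m a * homogeneousComponent n b := by
  have hsum : ∀ {c : MvPolynomial σ R} {k : ℕ}, c.totalDegree ≤ k →
      c = ∑ i ∈ Finset.range (k + 1), homogeneousComponent i c := by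
    intro c k hc
    conv_lhs => rw [← sum_homogeneousComponent c]
    refine Finset.sum_subset (Finset.range_mono (by omega)) fun i _ hi => ?_
    exact homogeneousComponent_eq_zero _ _ (by simpa using hi)
  conv_lhs => rw [hsum ha, hsum hb]
  rw [Finset.sum_mul_sum, map_sum, Finset.sum_eq_single m]
  · rw [map_sum, Finset.sum_eq_single n]
    · rw [homogeneousComponent_of_mem ((homogeneousComponent_isHomogeneous m a).mul
        (homogeneousComponent_isHomogeneous n b)), if_pos rfl]
    · intro j hj hjn
      rw [homogeneousComponent_of_mem ((homogeneousComponent_isHomogeneous m a).mul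
        (homogeneousComponent_isHomogeneous j b)), if_neg (by omega)]
    · simp
  · intro i hi him
    rw [map_sum]
    refine Finset.sum_eq_zero fun j hj => ?_
    simp only [Finset.mem_range] at hi hj
    rw [homogeneousComponent_of_mem ((homogeneousComponent_isHomogeneous i a).mul
      (homogeneousComponent_isHomogeneous j b)), if_neg (by omega)]
  · simp

theorem homogeneousComponent_mul_pow {σ R : Type*} [CommRing R] {m : ℕ} {a : MvPolynomial σ R}
    (ha : a.totalDegree ≤ m) (k : ℕ) :
    homogeneousComponent (k * m) (a ^ k) = homogeneousComponent m a ^ k := by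
  induction k with
  | zero => simp
  | succ k ih =>
    rw [pow_succ, pow_succ, add_mul, one_mul, homogeneousComponent_add_mul _ ha, ih]
    exact (totalDegree_pow _ _).trans (Nat.mul_le_mul_left _ ha)

theorem homogeneousComponent_totalDegree_ne_zero {σ R : Type*} [CommRing R] {a : MvPolynomial σ R}
    (ha : a ≠ 0) : homogeneousComponent a.totalDegree a ≠ 0 := by
  obtain ⟨m, hm, hd⟩ : ∃ m ∈ a.support, a.totalDegree = m.degree := by
    obtain ⟨m, hm, hd⟩ := Finset.exists_mem_eq_sup a.support (support_nonempty.mpr ha)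
      (fun m => m.sum fun _ e => e)
    exact ⟨m, hm, by rw [totalDegree, hd]; rfl⟩
  intro h
  have := congrArg (coeff m) h
  rw [coeff_homogeneousComponent, if_pos hd.symm] at this
  exact (mem_support_iff.mp hm) (by simpa using this)

/-- A zero of the top form of `u` is a zero of the form of degree `N` of every multiple of `u` of
degree at most `N`. -/
theorem eval_homogeneousComponent_eq_zero_of_dvd {u b : MvPolynomial (Fin 2) K} {N : ℕ}
    {p : Fin 2 → K} (hp : eval p (homogeneousComponent u.totalDegree u) = 0) (hub : u ∣ b)
    (hb : b.totalDegree ≤ N) : eval p (homogeneousComponent N b) = 0 := by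
  obtain ⟨r, rfl⟩ := hub
  by_cases h0 : u * r = 0
  · simp [h0]
  rw [totalDegree_mul_of_isDomain (left_ne_zero_of_mul h0) (right_ne_zero_of_mul h0)] at hb
  obtain ⟨k, rfl⟩ := Nat.exists_eq_add_of_le ((Nat.le_add_right _ _).trans hb)
  rw [homogeneousComponent_add_mul le_rfl (by omega), map_mul, hp, zero_mul]

/-! ### Points at infinity with values in a valued field -/

section Valued

variable {Ω Γ : Type*} [Field Ω] [Algebra K Ω] [LinearOrderedCommGroupWithZero Γ]

/-- The point `ξ` of the affine plane over the valued field `Ω` specializes to the point of the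
line at infinity with homogeneous coordinates `p`; the parameter `s`, of positive valuation, is a
local equation of that line along `ξ`. -/
structure TendsToInfinity (v : Valuation Ω Γ) (ξ : Fin 2 → Ω) (s : Ω) (p : Fin 2 → K) : Prop where
  ne_zero : s ≠ 0
  lt_one : v s < 1
  close : ∀ i, v (s * ξ i - algebraMap K Ω (p i)) < 1

variable {v : Valuation Ω Γ} [hv : v.IsTrivialOn K]

theorem valuation_algebraMap_le_one (v : Valuation Ω Γ) [hv : v.IsTrivialOn K] (a : K) :
    v (algebraMap K Ω a) ≤ 1 := by
  by_cases h : a = 0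
  · simp [h]
  · exact (hv.eq_one a h).le

theorem eq_zero_of_valuation_algebraMap_lt_one (v : Valuation Ω Γ) [hv : v.IsTrivialOn K] {a : K}
    (h : v (algebraMap K Ω a) < 1) : a = 0 := by
  by_contra h0
  exact h.ne (hv.eq_one a h0)

theorem valuation_aeval_sub_lt_one {η : Fin 2 → Ω} {p : Fin 2 → K}
    (h : ∀ i, v (η i - algebraMap K Ω (p i)) < 1) (a : MvPolynomial (Fin 2) K) :
    v (aeval η a - algebraMap K Ω (eval p a)) < 1 := by
  induction a using MvPolynomial.induction_on with
  | C c => simp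
  | add a b ha hb =>
    rw [map_add, map_add, map_add, add_sub_add_comm]
    exact v.map_add_lt ha hb
  | mul_X a i ha =>
    have : aeval η (a * X i) - algebraMap K Ω (eval p (a * X i)) =
        (aeval η a - algebraMap K Ω (eval p a)) * (η i - algebraMap K Ω (p i)) +
        ((aeval η a - algebraMap K Ω (eval p a)) * algebraMap K Ω (p i) +
        algebraMap K Ω (eval p a) * (η i - algebraMap K Ω (p i))) := by
      simp only [map_mul, aeval_X, eval_X]; ring
    rw [this]
    refine v.map_add_lt ?_ (v.map_add_lt ?_ ?_) <;> rw [map_mul]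
    · exact mul_lt_one_of_lt_of_le ha (h i).le
    · exact mul_lt_one_of_lt_of_le ha (valuation_algebraMap_le_one v _)
    · rw [mul_comm]
      exact mul_lt_one_of_lt_of_le (h i) (valuation_algebraMap_le_one v _)

theorem valuation_aeval_le_one {η : Fin 2 → Ω} {p : Fin 2 → K}
    (h : ∀ i, v (η i - algebraMap K Ω (p i)) < 1) (a : MvPolynomial (Fin 2) K) :
    v (aeval η a) ≤ 1 := by
  have := v.map_add_le (valuation_aeval_sub_lt_one h a).le
    (valuation_algebraMap_le_one v (eval p a))
  simpa using this

theorem aeval_smul_of_isHomogeneous {a : MvPolynomial (Fin 2) K} {j : ℕ} (ha : a.IsHomogeneous j)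
    (s : Ω) (ξ : Fin 2 → Ω) : aeval (fun i => s * ξ i) a = s ^ j * aeval ξ a := by
  rw [aeval_def, eval₂_eq, aeval_def, eval₂_eq, Finset.mul_sum]
  refine Finset.sum_congr rfl fun m hm => ?_
  have : s ^ j = ∏ i ∈ m.support, s ^ m i := by
    rw [Finset.prod_pow_eq_pow_sum, ha.degree_eq_sum_deg_support hm]
  simp only [mul_pow, Finset.prod_mul_distrib]
  rw [this]; ring

/-- The leading behaviour at a point at infinity of a polynomial of degree at most `e` is governed
by its form of degree `e`. -/
theorem TendsToInfinity.valuation_aeval_sub_lt_one {ξ : Fin 2 → Ω} {s : Ω} {p : Fin 2 → K}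
    (h : TendsToInfinity v ξ s p) {a : MvPolynomial (Fin 2) K} {e : ℕ} (ha : a.totalDegree ≤ e) :
    v (s ^ e * aeval ξ a - algebraMap K Ω (eval p (homogeneousComponent e a))) < 1 := by
  have key : s ^ e * aeval ξ a = ∑ j ∈ Finset.range (e + 1),
      s ^ (e - j) * aeval (fun i => s * ξ i) (homogeneousComponent j a) := by
    have hsum : a = ∑ i ∈ Finset.range (e + 1), homogeneousComponent i a := by
      conv_lhs => rw [← sum_homogeneousComponent a]
      refine Finset.sum_subset (Finset.range_mono (by omega)) fun i _ hi => ?_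
      exact homogeneousComponent_eq_zero _ _ (by simpa using hi)
    conv_lhs => rw [hsum]
    rw [map_sum, Finset.mul_sum]
    refine Finset.sum_congr rfl fun j hj => ?_
    rw [aeval_smul_of_isHomogeneous (homogeneousComponent_isHomogeneous j a), ← mul_assoc, ← pow_add]
    congr 2
    have := Finset.mem_range.mp hj
    omega
  rw [key, Finset.sum_range_succ, add_sub_assoc]
  refine v.map_add_lt (v.map_sum_lt one_ne_zero fun j hj => ?_) ?_
  · rw [map_mul, map_pow]
    refine mul_lt_one_of_lt_of_le (pow_lt_one₀ zero_le h.lt_one ?_)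
      (valuation_aeval_le_one h.close _)
    have := Finset.mem_range.mp hj
    omega
  · simpa using _root_.valuation_aeval_sub_lt_one h.close (homogeneousComponent e a)

theorem TendsToInfinity.valuation_aeval_le_one {ξ : Fin 2 → Ω} {s : Ω} {p : Fin 2 → K}
    (h : TendsToInfinity v ξ s p) {a : MvPolynomial (Fin 2) K} {e : ℕ} (ha : a.totalDegree ≤ e) :
    v (s ^ e * aeval ξ a) ≤ 1 := by
  have := v.map_add_le (h.valuation_aeval_sub_lt_one ha).le
    (valuation_algebraMap_le_one v (eval p (homogeneousComponent e a)))
  simpa using this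

theorem TendsToInfinity.valuation_aeval_eq_one {ξ : Fin 2 → Ω} {s : Ω} {p : Fin 2 → K}
    (h : TendsToInfinity v ξ s p) {a : MvPolynomial (Fin 2) K} {e : ℕ} (ha : a.totalDegree ≤ e)
    (h0 : eval p (homogeneousComponent e a) ≠ 0) : v (s ^ e * aeval ξ a) = 1 := by
  rw [← hv.eq_one _ h0]
  refine v.map_eq_of_sub_lt ?_
  rw [hv.eq_one _ h0]
  exact h.valuation_aeval_sub_lt_one ha

/-- The image of a point at infinity under a polynomial map whose forms of degree `d` take the
values `r` at it. -/
theorem TendsToInfinity.map {ξ : Fin 2 → Ω} {s : Ω} {p : Fin 2 → K}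
    (h : TendsToInfinity v ξ s p) (φ : MvPolynomial (Fin 2) K →ₐ[K] MvPolynomial (Fin 2) K)
    {d : ℕ} (hd : d ≠ 0) (hφ : ∀ i, (φ (X i)).totalDegree ≤ d) {r : Fin 2 → K}
    (hr : ∀ i, eval p (homogeneousComponent d (φ (X i))) = r i) :
    TendsToInfinity v (fun i => aeval ξ (φ (X i))) (s ^ d) r where
  ne_zero := pow_ne_zero _ h.ne_zero
  lt_one := by rw [map_pow]; exact pow_lt_one₀ zero_le h.lt_one hd
  close i := by rw [← hr i]; exact h.valuation_aeval_sub_lt_one (hφ i)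

theorem TendsToInfinity.valuation_mul_apply_eq_one {ξ : Fin 2 → Ω} {s : Ω} {p : Fin 2 → K}
    (h : TendsToInfinity v ξ s p) {i : Fin 2} (hi : p i ≠ 0) : v (s * ξ i) = 1 := by
  rw [← hv.eq_one _ hi]
  refine v.map_eq_of_sub_lt ?_
  rw [hv.eq_one _ hi]
  exact h.close i

theorem TendsToInfinity.valuation_mul_apply_le_one {ξ : Fin 2 → Ω} {s : Ω} {p : Fin 2 → K}
    (h : TendsToInfinity v ξ s p) (i : Fin 2) : v (s * ξ i) ≤ 1 := by
  have := v.map_add_le (h.close i).le (valuation_algebraMap_le_one v (p i))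
  simpa using this

theorem TendsToInfinity.valuation_le {ξ : Fin 2 → Ω} {s t : Ω} {p q : Fin 2 → K}
    (h : TendsToInfinity v ξ s p) (h' : TendsToInfinity v ξ t q) (hp : p ≠ 0) : v t ≤ v s := by
  obtain ⟨i, hi⟩ := Function.ne_iff.mp hp
  have h1 := h.valuation_mul_apply_eq_one hi
  have h2 := h'.valuation_mul_apply_le_one i
  rw [← h1, map_mul, map_mul] at h2
  have : v (ξ i) ≠ 0 := by
    intro h0
    rw [map_mul, h0, mul_zero] at h1
    exact zero_ne_one h1
  exact le_of_mul_le_mul_right h2 (zero_lt_iff.mpr this)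

theorem TendsToInfinity.valuation_eq {ξ : Fin 2 → Ω} {s t : Ω} {p q : Fin 2 → K}
    (h : TendsToInfinity v ξ s p) (h' : TendsToInfinity v ξ t q) (hp : p ≠ 0) (hq : q ≠ 0) :
    v s = v t :=
  le_antisymm (h'.valuation_le h hq) (h.valuation_le h' hp)

/-- The specialization of a point at infinity is unique as a point of the projective line. -/
theorem TendsToInfinity.parallel {ξ : Fin 2 → Ω} {s t : Ω} {p q : Fin 2 → K}
    (h : TendsToInfinity v ξ s p) (h' : TendsToInfinity v ξ t q) : p 0 * q 1 = p 1 * q 0 := by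
  rw [← sub_eq_zero]
  refine eq_zero_of_valuation_algebraMap_lt_one v ?_
  have : algebraMap K Ω (p 0 * q 1 - p 1 * q 0) =
      (s * ξ 1 * (t * ξ 0 - algebraMap K Ω (q 0)) - s * ξ 0 * (t * ξ 1 - algebraMap K Ω (q 1))) +
      ((s * ξ 1 - algebraMap K Ω (p 1)) * algebraMap K Ω (q 0) -
        (s * ξ 0 - algebraMap K Ω (p 0)) * algebraMap K Ω (q 1)) := by
    simp only [map_sub, map_mul]; ring
  rw [this]
  refine v.map_add_lt (v.map_sub_lt ?_ ?_) (v.map_sub_lt ?_ ?_) <;> rw [map_mul]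
  · rw [mul_comm]
    exact mul_lt_one_of_lt_of_le (h'.close 0) (h.valuation_mul_apply_le_one 1)
  · rw [mul_comm]
    exact mul_lt_one_of_lt_of_le (h'.close 1) (h.valuation_mul_apply_le_one 0)
  · exact mul_lt_one_of_lt_of_le (h.close 1) (valuation_algebraMap_le_one v _)
  · exact mul_lt_one_of_lt_of_le (h.close 0) (valuation_algebraMap_le_one v _)

end Valued

/-- A plane curve passes through every zero at infinity of the top form of its equation: its
function field carries a valuation centred there. -/
theorem exists_tendsToInfinity {w : MvPolynomial (Fin 2) K} (hw : Irreducible w) {p : Fin 2 → K}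
    (hp : p ≠ 0) (hwp : eval p (homogeneousComponent w.totalDegree w) = 0) :
    ∃ (Ω : Type u) (_ : Field Ω) (_ : Algebra K Ω) (Γ : Type u)
      (_ : LinearOrderedCommGroupWithZero Γ) (v : Valuation Ω Γ) (_ : v.IsTrivialOn K)
      (ξ : Fin 2 → Ω) (s : Ω), aeval ξ w = 0 ∧ TendsToInfinity v ξ s p := by
  have hprime : (Ideal.span {w}).IsPrime :=
    (Ideal.span_singleton_prime hw.ne_zero).mpr hw.prime
  let D := MvPolynomial (Fin 2) K ⧸ Ideal.span {w}
  let Ω := FractionRing D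
  let mk : MvPolynomial (Fin 2) K →ₐ[K] Ω :=
    (IsScalarTower.toAlgHom K D Ω).comp (Ideal.Quotient.mkₐ K (Ideal.span {w}))
  have hmk : ∀ a, mk a = 0 ↔ w ∣ a := by
    intro a
    have : mk a = algebraMap D Ω (Ideal.Quotient.mk _ a) := rfl
    rw [this, FaithfulSMul.algebraMap_eq_zero_iff, Ideal.Quotient.eq_zero_iff_mem,
      Ideal.mem_span_singleton]
  let ξ : Fin 2 → Ω := fun i => mk (X i)
  have hξ : ∀ a, aeval ξ a = mk a := by
    intro a
    have : aeval ξ = mk := by ext i; simp [ξ]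
    rw [this]
  obtain ⟨k, hk⟩ := Function.ne_iff.mp hp
  simp only [Pi.zero_apply] at hk
  -- The linear form `l` equals `1` at `p`, and its inverse along the curve is the parameter `s`.
  let l : MvPolynomial (Fin 2) K := C (p k)⁻¹ * X k
  have hl1 : l.totalDegree ≤ 1 := (isHomogeneous_C_mul_X _ _).totalDegree_le
  have hlp : eval p (homogeneousComponent 1 l) = 1 := by
    rw [homogeneousComponent_eq_self (isHomogeneous_C_mul_X _ _)]
    simp [hk]
  have hl0 : mk l ≠ 0 := fun h0 => by
    have := eval_homogeneousComponent_eq_zero_of_dvd hwp ((hmk l).mp h0) hl1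
    rw [hlp] at this
    exact one_ne_zero this
  have hlpow : ∀ n, (l ^ n).totalDegree ≤ n := fun n =>
    (totalDegree_pow _ _).trans (by simpa using Nat.mul_le_mul_left n hl1)
  have hlppow : ∀ n, eval p (homogeneousComponent n (l ^ n)) = 1 := fun n => by
    have := homogeneousComponent_mul_pow hl1 n
    rw [mul_one] at this
    rw [this, map_pow, hlp, one_pow]
  let s : Ω := (mk l)⁻¹
  have hsl : ∀ n, s ^ n * mk (l ^ n) = 1 := fun n => by
    rw [map_pow, ← mul_pow, inv_mul_cancel₀ hl0, one_pow]
  have hdeg : ∀ {a b : MvPolynomial (Fin 2) K} {m n : ℕ}, a.totalDegree ≤ m → b.totalDegree ≤ n →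
      (a * b).totalDegree ≤ m + n := fun ha hb =>
    (totalDegree_mul _ _).trans (Nat.add_le_add ha hb)
  have hadd : ∀ (a b : MvPolynomial (Fin 2) K) (m n : ℕ),
      s ^ m * mk a + s ^ n * mk b = s ^ (m + n) * mk (a * l ^ n + l ^ m * b) := by
    intro a b m n
    rw [map_add, map_mul, map_mul, pow_add]
    linear_combination (-(s ^ m * mk a)) * hsl n - (s ^ n * mk b) * hsl m
  let B : Subring Ω :=
    { carrier := {x | ∃ (n : ℕ) (a : MvPolynomial (Fin 2) K), a.totalDegree ≤ n ∧ x = s ^ n * mk a}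
      mul_mem' := by
        rintro _ _ ⟨m, a, ha, rfl⟩ ⟨n, b, hb, rfl⟩
        exact ⟨m + n, a * b, hdeg ha hb, by rw [map_mul]; ring⟩
      one_mem' := ⟨0, 1, by simp, by simp⟩
      add_mem' := by
        rintro _ _ ⟨m, a, ha, rfl⟩ ⟨n, b, hb, rfl⟩
        exact ⟨m + n, _, (totalDegree_add _ _).trans
          (max_le (hdeg ha (hlpow n)) (hdeg (hlpow m) hb)), hadd a b m n⟩
      zero_mem' := ⟨0, 0, by simp, by simp⟩
      neg_mem' := by
        rintro _ ⟨m, a, ha, rfl⟩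
        exact ⟨m, -a, by simpa using ha, by rw [map_neg, mul_neg]⟩ }
  let I : Ideal B :=
    { carrier := {x | ∃ (n : ℕ) (a : MvPolynomial (Fin 2) K), a.totalDegree ≤ n ∧
        eval p (homogeneousComponent n a) = 0 ∧ (x : Ω) = s ^ n * mk a}
      add_mem' := by
        rintro ⟨_, _⟩ ⟨_, _⟩ ⟨m, a, ha, hpa, rfl⟩ ⟨n, b, hb, hpb, rfl⟩
        refine ⟨m + n, _, (totalDegree_add _ _).trans
          (max_le (hdeg ha (hlpow n)) (hdeg (hlpow m) hb)), ?_, hadd a b m n⟩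
        rw [map_add, homogeneousComponent_add_mul ha (hlpow n),
          homogeneousComponent_add_mul (hlpow m) hb, map_add, map_mul, map_mul, hpa, hpb]
        simp
      zero_mem' := ⟨0, 0, by simp, by simp, by simp⟩
      smul_mem' := by
        rintro ⟨_, ⟨m, a, ha, rfl⟩⟩ ⟨_, _⟩ ⟨n, b, hb, hpb, rfl⟩
        refine ⟨m + n, a * b, hdeg ha hb, ?_, ?_⟩
        · rw [homogeneousComponent_add_mul ha hb, map_mul, hpb, mul_zero]
        · simp only [smul_eq_mul, Subring.coe_mul, map_mul]
          ring }
  have hI : I ≠ ⊤ := by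
    rw [Ideal.ne_top_iff_one]
    rintro ⟨n, a, ha, hpa, h1⟩
    have hdvd : w ∣ l ^ n - a := by
      rw [← hmk, map_sub, sub_eq_zero]
      refine mul_left_cancel₀ (pow_ne_zero n (inv_ne_zero hl0)) ?_
      exact (hsl n).trans h1
    have := eval_homogeneousComponent_eq_zero_of_dvd (N := n) hwp hdvd
      ((totalDegree_sub _ _).trans (max_le (hlpow n) ha))
    rw [map_sub, map_sub, hlppow, hpa] at this
    simp at this
  obtain ⟨V, hBV, hIV⟩ := Ideal.image_subset_nonunits_valuationSubring I hI
  have hVlt : ∀ x : Ω, (∃ (n : ℕ) (a : MvPolynomial (Fin 2) K), a.totalDegree ≤ n ∧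
      eval p (homogeneousComponent n a) = 0 ∧ x = s ^ n * mk a) → V.valuation x < 1 := by
    rintro x ⟨n, a, ha, hpa, hx⟩
    exact V.mem_nonunits_iff.mp (hIV ⟨⟨x, n, a, ha, hx⟩, ⟨n, a, ha, hpa, hx⟩, rfl⟩)
  have hle : ∀ c : K, V.valuation (algebraMap K Ω c) ≤ 1 := fun c =>
    (V.valuation_le_one_iff _).mpr (hBV ⟨0, C c, by simp, by
      rw [pow_zero, one_mul]; exact (mk.commutes c).symm⟩)
  have hV : V.valuation.IsTrivialOn K := ⟨fun c hc => by
    refine le_antisymm (hle c) ?_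
    have h1 := hle c⁻¹
    have h2 : V.valuation (algebraMap K Ω c) * V.valuation (algebraMap K Ω c⁻¹) = 1 := by
      rw [← map_mul, ← map_mul, mul_inv_cancel₀ hc, map_one, map_one]
    calc (1 : V.ValueGroup) = _ := h2.symm
      _ ≤ V.valuation (algebraMap K Ω c) * 1 := mul_le_mul_right h1 _
      _ = _ := mul_one _⟩
  refine ⟨Ω, inferInstance, inferInstance, V.ValueGroup, inferInstance, V.valuation, hV, ξ, s,
    by rw [hξ, hmk], inv_ne_zero hl0, hVlt _ ⟨1, 1, by simp, ?_, by simp⟩, fun i => ?_⟩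
  · rw [homogeneousComponent_eq_zero _ _ (by simp), map_zero]
  · refine hVlt _ ⟨1, X i - C (p i) * l, ?_, ?_, ?_⟩
    · refine (totalDegree_sub _ _).trans (max_le (isHomogeneous_X _ _).totalDegree_le ?_)
      exact (totalDegree_mul _ _).trans (by simpa using hl1)
    · rw [map_sub, homogeneousComponent_C_mul, map_sub, map_mul, hlp,
        homogeneousComponent_eq_self (isHomogeneous_X _ _)]
      simp
    · have h1 := hsl 1
      rw [pow_one, pow_one] at h1
      have h2 : mk (C (p i)) = algebraMap K Ω (p i) := mk.commutes _
      rw [map_sub, map_mul, h2, pow_one]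
      simp only [ξ]
      linear_combination (algebraMap K Ω (p i)) * h1

/-! ### Automorphisms contracting the line at infinity -/

/-- The forms of degree `d` of the components of `φ` are the coordinates of `p` times `H`: the
extension of the polynomial map to the projective plane contracts the line at infinity to `p`. -/
structure ContractsInfinity (φ : MvPolynomial (Fin 2) K ≃ₐ[K] MvPolynomial (Fin 2) K) (d : ℕ)
    (p : Fin 2 → K) (H : MvPolynomial (Fin 2) K) : Prop where
  ne_zero : p ≠ 0
  form_ne_zero : H ≠ 0
  isHomogeneous : H.IsHomogeneous d
  totalDegree_le : ∀ i, (φ (X i)).totalDegree ≤ d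
  homogeneousComponent_eq : ∀ i, homogeneousComponent d (φ (X i)) = C (p i) * H

/-- A regular automorphism of degree `d`, in terms of its action `φ` on polynomials: the line at
infinity is contracted to a point `p` where the extension is defined. -/
structure IsRegularWith (φ : MvPolynomial (Fin 2) K ≃ₐ[K] MvPolynomial (Fin 2) K) (d : ℕ)
    (p : Fin 2 → K) (H : MvPolynomial (Fin 2) K) : Prop extends ContractsInfinity φ d p H where
  two_le : 2 ≤ d
  eval_ne_zero : eval p H ≠ 0

theorem aeval_algEquiv_apply {Ω : Type*} [Field Ω] [Algebra K Ω]
    (φ : MvPolynomial (Fin 2) K ≃ₐ[K] MvPolynomial (Fin 2) K) (ξ : Fin 2 → Ω)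
    (a : MvPolynomial (Fin 2) K) :
    aeval (fun i => aeval ξ (φ (X i))) a = aeval ξ (φ a) := by
  have : aeval (fun i => aeval ξ (φ (X i))) = (aeval ξ).comp φ.toAlgHom := by
    ext i; simp
  rw [this]; rfl

theorem eval_smul_of_isHomogeneous {a : MvPolynomial (Fin 2) K} {j : ℕ} (ha : a.IsHomogeneous j)
    (c : K) (q : Fin 2 → K) : eval (c • q) a = c ^ j * eval q a := by
  have := aeval_smul_of_isHomogeneous ha c q
  rw [aeval_eq_eval] at this
  exact this

theorem algEquiv_irreducible (φ : MvPolynomial (Fin 2) K ≃ₐ[K] MvPolynomial (Fin 2) K)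
    {h : MvPolynomial (Fin 2) K} (hh : Irreducible h) : Irreducible (φ h) :=
  (MulEquiv.irreducible_iff φ).mpr hh

theorem totalDegree_pos_of_irreducible {h : MvPolynomial (Fin 2) K} (hh : Irreducible h) :
    0 < h.totalDegree := by
  rw [Nat.pos_iff_ne_zero]
  intro h0
  refine hh.not_isUnit (isUnit_iff_totalDegree_of_isReduced.mpr ⟨?_, h0⟩)
  rw [totalDegree_eq_zero_iff_eq_C] at h0
  rw [isUnit_iff_ne_zero]
  intro hc
  rw [hc, C_0] at h0
  exact hh.ne_zero h0

theorem parallel_trans {p q r : Fin 2 → K} (hq : q ≠ 0) (h1 : q 0 * p 1 = q 1 * p 0)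
    (h2 : q 0 * r 1 = q 1 * r 0) : p 0 * r 1 = p 1 * r 0 := by
  have h3 : ∃ i, q i ≠ 0 := by simpa using Function.ne_iff.mp hq
  obtain ⟨i, hi⟩ := h3
  fin_cases i
  · refine mul_left_cancel₀ hi ?_
    simp only [Fin.zero_eta]
    linear_combination p 0 * h2 - r 0 * h1
  · refine mul_left_cancel₀ hi ?_
    simp only [Fin.mk_one]
    linear_combination p 1 * h2 - r 1 * h1

/-- The linear form vanishing on the multiples of `p`. -/
noncomputable def normalForm (p : Fin 2 → K) : MvPolynomial (Fin 2) K :=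
  C (p 1) * X 0 - C (p 0) * X 1

theorem normalForm_isHomogeneous (p : Fin 2 → K) : (normalForm p).IsHomogeneous 1 :=
  (isHomogeneous_C_mul_X _ _).sub (isHomogeneous_C_mul_X _ _)

theorem aeval_normalForm {Ω : Type*} [CommRing Ω] [Algebra K Ω] (p : Fin 2 → K) (ξ : Fin 2 → Ω) :
    aeval ξ (normalForm p) = algebraMap K Ω (p 1) * ξ 0 - algebraMap K Ω (p 0) * ξ 1 := by
  simp [normalForm]

theorem normalForm_ne_zero {p : Fin 2 → K} (hp : p ≠ 0) : normalForm p ≠ 0 := by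
  intro h
  apply hp
  have h0 : eval ![1, 0] (normalForm p) = 0 := by rw [h, map_zero]
  have h1 : eval ![0, 1] (normalForm p) = 0 := by rw [h, map_zero]
  simp [normalForm] at h0 h1
  ext i; fin_cases i <;> simp [h0, h1]

theorem normalForm_totalDegree {p : Fin 2 → K} (hp : p ≠ 0) : (normalForm p).totalDegree = 1 :=
  (normalForm_isHomogeneous p).totalDegree (normalForm_ne_zero hp)

theorem normalForm_irreducible {p : Fin 2 → K} (hp : p ≠ 0) : Irreducible (normalForm p) := by
  refine irreducible_of_totalDegree_eq_one (normalForm_totalDegree hp) fun x hx => ?_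
  rw [isUnit_iff_ne_zero]
  rintro rfl
  refine normalForm_ne_zero hp (MvPolynomial.ext _ _ fun m => ?_)
  simpa using hx m

theorem exists_tendsToInfinity_of_direction (q : Fin 2 → K) :
    ∃ (Ω : Type u) (_ : Field Ω) (_ : Algebra K Ω) (Γ : Type u)
      (_ : LinearOrderedCommGroupWithZero Γ) (v : Valuation Ω Γ) (_ : v.IsTrivialOn K)
      (ξ : Fin 2 → Ω) (s : Ω), TendsToInfinity v ξ s q := by
  have hp : (![1, 0] : Fin 2 → K) ≠ 0 := fun h => by simpa using congrFun h 0
  obtain ⟨Ω, _, _, Γ, _, v, hv, ξ, s, -, h⟩ := exists_tendsToInfinity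
    (normalForm_irreducible hp) hp (by
      rw [normalForm_totalDegree hp, homogeneousComponent_eq_self (normalForm_isHomogeneous _)]
      simp [normalForm])
  exact ⟨Ω, _, _, Γ, _, v, hv, fun i => algebraMap K Ω (q i) / s, s, h.ne_zero, h.lt_one,
    fun i => by rw [mul_div_cancel₀ _ h.ne_zero]; simp⟩

section Maps

variable {φ ψ : MvPolynomial (Fin 2) K ≃ₐ[K] MvPolynomial (Fin 2) K} {d d' : ℕ}
  {p p' q : Fin 2 → K} {H H' : MvPolynomial (Fin 2) K}

theorem IsRegularWith.map {Ω Γ : Type*} [Field Ω] [Algebra K Ω]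
    [LinearOrderedCommGroupWithZero Γ] {v : Valuation Ω Γ} [hv : v.IsTrivialOn K]
    (hφ : IsRegularWith φ d p H) {ξ : Fin 2 → Ω} {s : Ω} (h : TendsToInfinity v ξ s q) :
    TendsToInfinity v (fun i => aeval ξ (φ (X i))) (s ^ d) (eval q H • p) :=
  h.map φ.toAlgHom (by have := hφ.two_le; omega) hφ.totalDegree_le fun i => by
    have := hφ.homogeneousComponent_eq i
    change eval q (homogeneousComponent d (φ (X i))) = _
    rw [this]; simp [mul_comm]

theorem IsRegularWith.map_pow {Ω Γ : Type*} [Field Ω] [Algebra K Ω]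
    [LinearOrderedCommGroupWithZero Γ] {v : Valuation Ω Γ} [hv : v.IsTrivialOn K]
    (hφ : IsRegularWith φ d p H) (n : ℕ) {ξ : Fin 2 → Ω} {s : Ω} {q : Fin 2 → K}
    (h : TendsToInfinity v ξ s q) (hq : eval q H ≠ 0) :
    ∃ c : K, c ≠ 0 ∧
      TendsToInfinity v (fun i => aeval ξ ((φ ^ (n + 1)) (X i))) (s ^ d ^ (n + 1)) (c • p) := by
  induction n generalizing ξ s q with
  | zero => exact ⟨_, hq, by simpa using hφ.map h⟩
  | succ n ih =>
    obtain ⟨c, hc, h'⟩ := ih (hφ.map h) (by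
      rw [eval_smul_of_isHomogeneous hφ.isHomogeneous]
      exact mul_ne_zero (pow_ne_zero _ hq) hφ.eval_ne_zero)
    refine ⟨c, hc, ?_⟩
    have e : ∀ i, aeval ξ ((φ ^ (n + 1 + 1)) (X i)) =
        aeval (fun j => aeval ξ (φ (X j))) ((φ ^ (n + 1)) (X i)) := fun i => by
      rw [aeval_algEquiv_apply, pow_succ' φ (n + 1)]; rfl
    simp only [e]
    rwa [← pow_mul, ← pow_succ'] at h'

/-- Composing with a regular map multiplies the degree of a curve not passing through `p`. -/
theorem IsRegularWith.mul_totalDegree_le (hφ : IsRegularWith φ d p H)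
    {w : MvPolynomial (Fin 2) K} (hw : eval p (homogeneousComponent w.totalDegree w) ≠ 0) :
    d * w.totalDegree ≤ (φ w).totalDegree := by
  by_contra! hlt
  obtain ⟨Ω, _, _, Γ, _, v, hv, ξ, s, h⟩ := exists_tendsToInfinity_of_direction p
  have h1 := (hφ.map h).valuation_aeval_eq_one (a := w) le_rfl (by
    rw [eval_smul_of_isHomogeneous (homogeneousComponent_isHomogeneous _ _)]
    exact mul_ne_zero (pow_ne_zero _ hφ.eval_ne_zero) hw)
  have h2 := h.valuation_aeval_le_one (a := φ w) le_rfl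
  rw [aeval_algEquiv_apply, ← pow_mul] at h1
  obtain ⟨k, hk⟩ := Nat.exists_eq_add_of_lt hlt
  rw [hk, add_assoc, add_comm, pow_add, mul_assoc, map_mul] at h1
  refine (mul_lt_one_of_lt_of_le ?_ h2).ne h1
  rw [_root_.map_pow]
  exact pow_lt_one₀ zero_le h.lt_one (by omega)

/-- If `φ` is regular, its inverse can become indeterminate only at the image `p` of the line at
infinity. Indeed a point of the line at infinity where `H'` vanishes lies on the image of the line
`normalForm p = 0`, whose only point at infinity is `p`, fixed by the regular map. -/
theorem IsRegularWith.parallel_of_eval_eq_zero (hφ : IsRegularWith φ d p H)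
    (hψ : ContractsInfinity φ.symm d' p' H') (hpp : p 0 * p' 1 ≠ p 1 * p' 0) (hq : q ≠ 0)
    (hqH : eval q H' = 0) : q 0 * p 1 = q 1 * p 0 := by
  set w := φ.symm (normalForm p) with hw
  have hwC : w = C (p 1) * φ.symm (X 0) - C (p 0) * φ.symm (X 1) := by
    have : ∀ c, φ.symm (C c) = C c := fun c => φ.symm.commutes c
    simp [hw, normalForm, this]
  have hwle : w.totalDegree ≤ d' := by
    rw [hwC]
    refine (totalDegree_sub _ _).trans (max_le ?_ ?_) <;>
    exact (totalDegree_mul _ _).trans (by simpa using hψ.totalDegree_le _)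
  have hwd : homogeneousComponent d' w = C (p 1 * p' 0 - p 0 * p' 1) * H' := by
    rw [hwC, map_sub, homogeneousComponent_C_mul, homogeneousComponent_C_mul,
      hψ.homogeneousComponent_eq, hψ.homogeneousComponent_eq]
    simp only [map_sub, map_mul]; ring
  have hw0 : homogeneousComponent d' w ≠ 0 := by
    rw [hwd]
    exact mul_ne_zero (by rw [Ne, C_eq_zero]; exact sub_ne_zero.mpr hpp.symm) hψ.form_ne_zero
  have hwdeg : w.totalDegree = d' := by
    refine hwle.antisymm ?_
    by_contra! h
    exact hw0 (homogeneousComponent_eq_zero _ _ h)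
  obtain ⟨Ω, _, _, Γ, _, v, hv, ξ, s, hξw, h⟩ := exists_tendsToInfinity
    (algEquiv_irreducible φ.symm (normalForm_irreducible hφ.ne_zero)) hq (by
      change eval q (homogeneousComponent w.totalDegree w) = 0
      rw [hwdeg, hwd, map_mul, hqH, mul_zero])
  set ζ : Fin 2 → Ω := fun i => aeval ξ (φ.symm (X i)) with hζ
  have hback : ∀ i, aeval ζ (φ (X i)) = ξ i := fun i => by
    rw [hζ, aeval_algEquiv_apply]; simp
  have hline : algebraMap K Ω (p 1) * ζ 0 = algebraMap K Ω (p 0) * ζ 1 := by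
    rw [← sub_eq_zero, ← aeval_normalForm, hζ, aeval_algEquiv_apply, hξw]
  obtain ⟨t, ht⟩ : ∃ t : Ω, ∀ i, ζ i = t * algebraMap K Ω (p i) := by
    have h3 : ∃ i, p i ≠ 0 := by simpa using Function.ne_iff.mp hφ.ne_zero
    obtain ⟨i, hi⟩ := h3
    have hi' : algebraMap K Ω (p i) ≠ 0 := by simpa using hi
    refine ⟨ζ i / algebraMap K Ω (p i), fun j => ?_⟩
    rw [div_mul_eq_mul_div, eq_div_iff hi']
    fin_cases i <;> fin_cases j <;> simp only [Fin.zero_eta, Fin.mk_one]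
    · linear_combination -hline
    · linear_combination hline
  rcases le_or_gt (v t) 1 with hvt | hvt
  · exfalso
    have hint : ∀ a : MvPolynomial (Fin 2) K, v (aeval ζ a) ≤ 1 := by
      intro a
      induction a using MvPolynomial.induction_on with
      | C c => simp
      | add a b ha hb => rw [map_add]; exact v.map_add_le ha hb
      | mul_X a i ha =>
        rw [map_mul, aeval_X, ht, map_mul, map_mul]
        exact mul_le_one' ha (mul_le_one' hvt (valuation_algebraMap_le_one v _))
    obtain ⟨i, hi⟩ := Function.ne_iff.mp hq
    have h1 := h.valuation_mul_apply_eq_one hi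
    rw [← hback, map_mul] at h1
    exact (mul_lt_one_of_lt_of_le h.lt_one (hint _)).ne h1
  · have ht0 : t ≠ 0 := by
      rintro rfl
      simp at hvt
    have h1 : TendsToInfinity v ζ t⁻¹ p :=
      ⟨inv_ne_zero ht0, by rw [map_inv₀]; exact inv_lt_one_of_one_lt₀ hvt, fun i => by
        rw [ht, inv_mul_cancel_left₀ ht0]; simp⟩
    have h2 := hφ.map h1
    simp only [hback] at h2
    have h3 := h.parallel h2
    simp only [Pi.smul_apply, smul_eq_mul] at h3
    refine mul_left_cancel₀ hφ.eval_ne_zero ?_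
    linear_combination h3

end Maps

/-- A zero of a binary form with values in an extension of an algebraically closed field is
proportional to a zero over that field. -/
theorem exists_zero_of_aeval_eq_zero [IsAlgClosed K] {L : Type u} [Field L] [Algebra K L]
    {H : MvPolynomial (Fin 2) K} {d : ℕ} (hH : H.IsHomogeneous d) {p : Fin 2 → K}
    (hp : eval p H ≠ 0) {a : Fin 2 → L} (ha : a ≠ 0) (haH : aeval a H = 0) (hp0 : p ≠ 0) :
    ∃ q : Fin 2 → K, q ≠ 0 ∧ eval q H = 0 ∧ ∃ b : L, ∀ i, a i = algebraMap K L (q i) * b := by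
  have aeval_alg : ∀ q : Fin 2 → K, aeval (fun i => algebraMap K L (q i)) H =
      algebraMap K L (eval q H) := fun q => by
    rw [← aeval_eq_eval, ← aeval_algebraMap_apply]; rfl
  obtain ⟨i, hi⟩ := Function.ne_iff.mp hp0
  simp only [Pi.zero_apply] at hi
  have hi' : algebraMap K L (p i) ≠ 0 := by simpa using hi
  obtain ⟨j, hji, hcov⟩ : ∃ j : Fin 2, j ≠ i ∧ ∀ k, k = i ∨ k = j := by
    fin_cases i
    · exact ⟨1, by simp, by intro k; fin_cases k <;> simp⟩
    · exact ⟨0, by simp, by intro k; fin_cases k <;> simp⟩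
  let e : Fin 2 → K := Pi.single j 1
  have hei : e i = 0 := by simp [e, hji.symm]
  have hej : e j = 1 := by simp [e]
  by_cases hai : a i = 0
  · have hae : ∀ k, a k = a j * algebraMap K L (e k) := by
      intro k
      rcases hcov k with rfl | rfl
      · simp [hai, hei]
      · simp [hej]
    have haj : a j ≠ 0 := by
      intro h
      exact ha (funext fun k => by rw [hae k, h, zero_mul]; rfl)
    refine ⟨e, fun h => by simpa [hej] using congrFun h j, ?_, a j, fun k => by rw [hae k, mul_comm]⟩
    have h1 : aeval (fun k => a j * algebraMap K L (e k)) H = 0 := by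
      rw [← haH]; congr 2; funext k; exact (hae k).symm
    rw [aeval_smul_of_isHomogeneous hH, aeval_alg] at h1
    simpa [haj] using h1
  · set α := a i / algebraMap K L (p i) with hα
    have hα0 : α ≠ 0 := div_ne_zero hai hi'
    set t := (a j - α * algebraMap K L (p j)) / α with ht
    have hat : ∀ k, a k = α * (algebraMap K L (p k) + algebraMap K L (e k) * t) := by
      intro k
      rcases hcov k with rfl | rfl
      · rw [hei, map_zero, zero_mul, add_zero, hα, div_mul_cancel₀ _ hi']
      · rw [hej, map_one, one_mul, mul_add, ht, mul_div_cancel₀ _ hα0]; ring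
    let χ : Polynomial K := aeval (fun k => Polynomial.C (p k) + Polynomial.C (e k) * Polynomial.X) H
    have hχ : ∀ {M : Type u} [CommRing M] [Algebra K M] (y : M), Polynomial.aeval y χ =
        aeval (fun k => algebraMap K M (p k) + algebraMap K M (e k) * y) H := by
      intro M _ _ y
      rw [← AlgHom.comp_apply]
      congr 1
      ext k; simp
    have hχ0 : χ ≠ 0 := by
      intro h
      have := hχ (0 : K)
      rw [h, map_zero] at this
      simp only [mul_zero, add_zero, Algebra.algebraMap_self, RingHom.id_apply] at this
      exact hp (by rw [← aeval_eq_eval]; exact this.symm)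
    have hroot : Polynomial.aeval t χ = 0 := by
      rw [hχ]
      have h1 : aeval (fun k => α * (algebraMap K L (p k) + algebraMap K L (e k) * t)) H = 0 := by
        rw [← haH]; congr 2; funext k; exact (hat k).symm
      rw [aeval_smul_of_isHomogeneous hH] at h1
      exact (mul_eq_zero.mp h1).resolve_left (pow_ne_zero _ hα0)
    obtain ⟨c, hc, hct⟩ : ∃ c ∈ χ.roots, algebraMap K L c = t := by
      have h1 : t ∈ (χ.map (algebraMap K L)).roots := by
        rw [Polynomial.mem_roots (by simpa using hχ0), Polynomial.IsRoot, Polynomial.eval_map_algebraMap]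
        exact hroot
      rw [(IsAlgClosed.splits χ).roots_map] at h1
      simpa using h1
    refine ⟨fun k => p k + e k * c, fun h => ?_, ?_, α, fun k => ?_⟩
    · have := congrFun h i
      simp only [hei, zero_mul, add_zero, Pi.zero_apply] at this
      exact hi this
    · have h1 := hχ c
      rw [Polynomial.mem_roots hχ0, Polynomial.IsRoot] at hc
      rw [Polynomial.coe_aeval_eq_eval, hc] at h1
      rw [← aeval_eq_eval]
      exact h1.symm
    · rw [hat k, ← hct, map_add, map_mul]; ring

section Inverse

variable {φ : MvPolynomial (Fin 2) K ≃ₐ[K] MvPolynomial (Fin 2) K} {d : ℕ}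
  {p : Fin 2 → K} {H : MvPolynomial (Fin 2) K}

theorem eval_eq_zero_of_isHomogeneous {a : MvPolynomial (Fin 2) K} {j : ℕ} (ha : a.IsHomogeneous j)
    (hj : j ≠ 0) : eval 0 a = 0 := by
  have := eval_smul_of_isHomogeneous ha 0 0
  rwa [zero_smul, zero_pow hj, zero_mul] at this

theorem totalDegree_algEquiv_ne_zero
    (φ : MvPolynomial (Fin 2) K ≃ₐ[K] MvPolynomial (Fin 2) K) {a : MvPolynomial (Fin 2) K}
    (ha : a.totalDegree ≠ 0) : (φ a).totalDegree ≠ 0 := by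
  intro h
  rw [totalDegree_eq_zero_iff_eq_C] at h
  have : a = C (coeff 0 (φ a)) := by
    apply φ.injective
    rw [h]
    simpa using (φ.commutes (coeff 0 (φ a))).symm
  rw [this] at ha
  simp at ha

/-- The inverse of a regular map contracts the line at infinity too: since composing with the
regular map must lower degrees, its top forms are annihilated by `H`, and `K` is algebraically
closed, so they are proportional. -/
theorem IsRegularWith.exists_contractsInfinity_symm [IsAlgClosed K] (hφ : IsRegularWith φ d p H) :
    ∃ d' p' H', ContractsInfinity φ.symm d' p' H' ∧ 2 ≤ d' ∧ eval p' H = 0 := by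
  have : Infinite K := IsAlgClosed.instInfinite
  set d' := max (φ.symm (X 0)).totalDegree (φ.symm (X 1)).totalDegree with hd'
  have hle : ∀ i, (φ.symm (X i)).totalDegree ≤ d' := by
    intro i; fin_cases i
    · exact le_max_left _ _
    · exact le_max_right _ _
  have hd1 : 1 ≤ d' := by
    refine le_trans ?_ (hle 0)
    exact Nat.one_le_iff_ne_zero.mpr (totalDegree_algEquiv_ne_zero _ (by simp))
  set r : Fin 2 → MvPolynomial (Fin 2) K := fun i => homogeneousComponent d' (φ.symm (X i)) with hr
  have hrh : ∀ i, (r i).IsHomogeneous d' := fun i => homogeneousComponent_isHomogeneous _ _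
  have hr0 : r ≠ 0 := by
    intro h0
    have h1 : ∀ i, d' ≠ (φ.symm (X i)).totalDegree := by
      intro i hi
      have h2 := congrFun h0 i
      simp only [hr, Pi.zero_apply] at h2
      rw [hi] at h2
      refine homogeneousComponent_totalDegree_ne_zero ?_ h2
      rw [Ne, map_eq_zero_iff _ φ.symm.injective]
      exact X_ne_zero i
    rcases le_total (φ.symm (X 0)).totalDegree (φ.symm (X 1)).totalDegree with h | h
    · exact h1 1 (max_eq_right h)
    · exact h1 0 (max_eq_left h)
  -- At a direction `q` with `H (r q) ≠ 0`, following the inverse by the regular map would multiply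
  -- the order of a pole by `d' * d`, but the composition is the identity.
  have hHr : aeval r H = 0 := by
    refine MvPolynomial.funext fun q => ?_
    have he : eval q (aeval r H) = eval (fun i => eval q (r i)) H := by
      rw [← aeval_eq_eval, ← aeval_eq_eval, ← AlgHom.comp_apply]
      congr 1
      ext i; simp [aeval_eq_eval]
    rw [he, map_zero]
    by_contra hne
    by_cases hq : q = 0
    · refine hne ?_
      have : (fun i => eval q (r i)) = 0 := by
        funext i
        rw [hq]
        exact eval_eq_zero_of_isHomogeneous (hrh i) (by omega)
      rw [this]
      exact eval_eq_zero_of_isHomogeneous hφ.isHomogeneous (by have := hφ.two_le; omega)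
    · obtain ⟨Ω, _, _, Γ, _, v, hv, ξ, s, h⟩ := exists_tendsToInfinity_of_direction q
      have h1 := h.map φ.symm.toAlgHom (d := d') (by omega) hle (r := fun i => eval q (r i))
        fun i => rfl
      have h2 := hφ.map h1
      have h3 : (fun i => aeval (fun i => aeval ξ (φ.symm.toAlgHom (X i))) (φ (X i))) = ξ := by
        funext i
        have := aeval_algEquiv_apply φ.symm ξ (φ (X i))
        simpa using this
      rw [h3] at h2
      have h4 := h.valuation_eq h2 hq (smul_ne_zero hne hφ.ne_zero)
      rw [← pow_mul, _root_.map_pow] at h4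
      refine (pow_lt_self_of_lt_one₀ (n := d' * d) ?_ h.lt_one ?_).ne h4.symm
      · rw [zero_lt_iff, Valuation.ne_zero_iff]; exact h.ne_zero
      · have := hφ.two_le; nlinarith
  obtain ⟨q, hq, hqH, b, hb⟩ := exists_zero_of_aeval_eq_zero (L := FractionRing (MvPolynomial (Fin 2) K))
    hφ.isHomogeneous hφ.eval_ne_zero
    (a := fun i => algebraMap _ (FractionRing (MvPolynomial (Fin 2) K)) (r i))
    (fun h => hr0 (funext fun i => by simpa using congrFun h i))
    (by
      change aeval (algebraMap _ (FractionRing (MvPolynomial (Fin 2) K)) ∘ r) H = 0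
      rw [aeval_algebraMap_apply, hHr, map_zero]) hφ.ne_zero
  obtain ⟨k, hk⟩ := Function.ne_iff.mp hq
  simp only [Pi.zero_apply] at hk
  have htop : ∀ i, r i = C (q i) * (C (q k)⁻¹ * r k) := by
    intro i
    apply IsFractionRing.injective (MvPolynomial (Fin 2) K)
      (FractionRing (MvPolynomial (Fin 2) K))
    have hC : ∀ c : K, algebraMap (MvPolynomial (Fin 2) K)
        (FractionRing (MvPolynomial (Fin 2) K)) (C c) = algebraMap K _ c := fun c =>
      (IsScalarTower.algebraMap_apply K (MvPolynomial (Fin 2) K) _ c).symm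
    have hk' : algebraMap K (FractionRing (MvPolynomial (Fin 2) K)) (q k) ≠ 0 := by simpa using hk
    rw [map_mul, map_mul, hC, hC, hb i, hb k, map_inv₀, inv_mul_cancel_left₀ hk']
  have hcon : ContractsInfinity φ.symm d' q (C (q k)⁻¹ * r k) :=
    { ne_zero := hq
      form_ne_zero := by
        intro h
        apply hr0
        funext i
        rw [htop i, h, mul_zero]; rfl
      isHomogeneous := (hrh k).C_mul _
      totalDegree_le := hle
      homogeneousComponent_eq := htop }
  refine ⟨d', q, _, hcon, ?_, hqH⟩
  -- If `d' = 1`, the linear form vanishing at `q` would be mapped to a constant.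
  by_contra! hlt
  have hd'1 : d' = 1 := by omega
  refine totalDegree_algEquiv_ne_zero φ.symm (a := normalForm q)
    (by rw [normalForm_totalDegree hq]; exact one_ne_zero) ?_
  have hw : φ.symm (normalForm q) = C (q 1) * φ.symm (X 0) - C (q 0) * φ.symm (X 1) := by
    have : ∀ c, φ.symm (C c) = C c := fun c => φ.symm.commutes c
    simp [normalForm, this]
  have hwle : (φ.symm (normalForm q)).totalDegree ≤ d' := by
    rw [hw]
    refine (totalDegree_sub _ _).trans (max_le ?_ ?_) <;>
    exact (totalDegree_mul _ _).trans (by simpa using hle _)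
  by_contra h0
  have h1 : (φ.symm (normalForm q)).totalDegree = d' := by omega
  refine homogeneousComponent_totalDegree_ne_zero (a := φ.symm (normalForm q)) ?_ ?_
  · intro h
    rw [h] at h0
    simp at h0
  · rw [h1, hw, map_sub, homogeneousComponent_C_mul, homogeneousComponent_C_mul,
      hcon.homogeneousComponent_eq, hcon.homogeneousComponent_eq]
    ring

/-- The inverse of a regular automorphism is regular, and the indeterminacy points of each of the
two are the points to which the other one contracts the line at infinity. -/
theorem IsRegularWith.exists_symm [IsAlgClosed K] (hφ : IsRegularWith φ d p H) :
    ∃ d' p' H', IsRegularWith φ.symm d' p' H' ∧ p 0 * p' 1 ≠ p 1 * p' 0 ∧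
      (∀ q, q ≠ 0 → eval q H' = 0 → q 0 * p 1 = q 1 * p 0) ∧
      (∀ q, q ≠ 0 → eval q H = 0 → q 0 * p' 1 = q 1 * p' 0) := by
  obtain ⟨d', p', H', hψ, hd', hp'⟩ := hφ.exists_contractsInfinity_symm
  have hpp : p 0 * p' 1 ≠ p 1 * p' 0 := by
    intro h
    obtain ⟨i, hi⟩ := Function.ne_iff.mp hψ.ne_zero
    simp only [Pi.zero_apply] at hi
    have hcp : p = (p i / p' i) • p' := by
      funext j
      rw [Pi.smul_apply, smul_eq_mul, div_mul_eq_mul_div, eq_div_iff hi]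
      fin_cases i <;> fin_cases j <;> simp only [Fin.zero_eta, Fin.mk_one]
      · linear_combination -h
      · linear_combination h
    apply hφ.eval_ne_zero
    rw [hcp, eval_smul_of_isHomogeneous hφ.isHomogeneous, hp', mul_zero]
  have h1 : ∀ q, q ≠ 0 → eval q H' = 0 → q 0 * p 1 = q 1 * p 0 := fun q hq =>
    hφ.parallel_of_eval_eq_zero hψ hpp hq
  have hψ' : IsRegularWith φ.symm d' p' H' :=
    { hψ with
      two_le := hd'
      eval_ne_zero := fun h => hpp (by
        have := h1 p' hψ.ne_zero h
        linear_combination -this) }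
  refine ⟨d', p', H', hψ', hpp, h1, fun q hq hqH => ?_⟩
  exact hψ'.parallel_of_eval_eq_zero (q := q) (d' := d) (p' := p) (H' := H)
    (by rw [AlgEquiv.symm_symm]; exact hφ.toContractsInfinity)
    (fun h => hpp (by linear_combination -h)) hq hqH

end Inverse

/-! ### Growth of the degrees of the iterates of a curve -/

theorem exists_aeval_eq_zero_of_mem_adjoin {L Ω : Type*} [Field L] [Field Ω] [Algebra L Ω] {y b : Ω}
    {χ : Polynomial L} (hχ : χ ≠ 0) (hy : Polynomial.aeval y χ = 0)
    (hb : b ∈ IntermediateField.adjoin L {y}) :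
    ∃ χ' : Polynomial L, χ' ≠ 0 ∧ Polynomial.aeval b χ' = 0 ∧ χ'.natDegree ≤ χ.natDegree := by
  have hint : IsIntegral L y := IsAlgebraic.isIntegral ⟨χ, hχ, hy⟩
  have := IntermediateField.adjoin.finiteDimensional hint
  let b' : IntermediateField.adjoin L {y} := ⟨b, hb⟩
  refine ⟨minpoly L b', minpoly.ne_zero (IsIntegral.of_finite L b'), ?_, ?_⟩
  · have := congrArg (algebraMap (IntermediateField.adjoin L {y}) Ω) (minpoly.aeval L b')
    rw [← Polynomial.aeval_algebraMap_apply, map_zero] at this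
    exact this
  · refine (minpoly.natDegree_le b').trans ?_
    rw [IntermediateField.adjoin.finrank hint]
    exact Polynomial.natDegree_le_of_dvd (minpoly.dvd L _ hy) hχ

/-- If `x` has the value of `s ^ (-D)`, an element `b` with the value of `s⁻¹` has degree at least
`D` over `K(x)`, since the values of nonzero elements of `K(x)` are powers of that of `x`. -/
theorem le_of_valuation_eq {Ω Γ : Type*} [Field Ω] [Algebra K Ω]
    [LinearOrderedCommGroupWithZero Γ] {v : Valuation Ω Γ} [hv : v.IsTrivialOn K]
    {x b s : Ω} {D : ℕ} (hs : v s < 1) (hD : D ≠ 0)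
    (hx : v (s ^ D * x) = 1) (hb : v (s * b) = 1)
    {χ : Polynomial (IntermediateField.adjoin K {x})} (hχ : χ ≠ 0)
    (hroot : Polynomial.aeval b χ = 0) : D ≤ χ.natDegree := by
  by_contra! hlt
  set σ := v s with hσ
  have hs0 : σ ≠ 0 := by
    intro h
    rw [map_mul, ← hσ, h, zero_mul] at hb
    exact zero_ne_one hb
  have hxv : v x = σ ^ (-(D : ℤ)) := by
    rw [map_mul, map_pow, ← hσ] at hx
    rw [zpow_neg, zpow_natCast]
    exact eq_inv_of_mul_eq_one_right hx
  have hbv : v b = σ ^ (-(1 : ℤ)) := by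
    rw [map_mul, ← hσ] at hb
    rw [zpow_neg, zpow_one]
    exact eq_inv_of_mul_eq_one_right hb
  have hx1 : 1 < v x := by
    rw [hxv, zpow_neg, zpow_natCast]
    exact (one_lt_inv₀ (pow_pos (zero_lt_iff.mpr hs0) _)).mpr (pow_lt_one₀ zero_le hs hD)
  have hval : ∀ l : IntermediateField.adjoin K {x}, l ≠ 0 →
      ∃ z : ℤ, v (l : Ω) = σ ^ ((D : ℤ) * z) := by
    rintro ⟨l, hl⟩ hl0
    obtain ⟨r, t, hrt⟩ := (IntermediateField.mem_adjoin_simple_iff K l).mp hl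
    have hl0' : l ≠ 0 := fun h => hl0 (Subtype.ext h)
    have hr : r ≠ 0 := by rintro rfl; simp at hrt; exact hl0' hrt
    have ht : t ≠ 0 := by rintro rfl; simp at hrt; exact hl0' hrt
    refine ⟨t.natDegree - r.natDegree, ?_⟩
    change v l = _
    rw [hrt, map_div₀,
      Polynomial.valuation_aeval_eq_valuation_X_pow_natDegree_of_one_lt_valuation_X x hx1 hr,
      Polynomial.valuation_aeval_eq_valuation_X_pow_natDegree_of_one_lt_valuation_X x hx1 ht,
      hxv, ← zpow_natCast, ← zpow_natCast, ← zpow_mul, ← zpow_mul, ← zpow_sub₀ hs0]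
    congr 1; ring
  have hterm : ∀ i ∈ χ.support, ∃ z : ℤ, v ((χ.coeff i : Ω) * b ^ i) = σ ^ ((D : ℤ) * z - i) := by
    intro i hi
    obtain ⟨z, hz⟩ := hval _ (Polynomial.mem_support_iff.mp hi)
    refine ⟨z, ?_⟩
    rw [map_mul, map_pow, hz, hbv, ← zpow_natCast, ← zpow_mul, ← zpow_add₀ hs0]
    congr 1; ring
  have hinj : Function.Injective fun z : ℤ => σ ^ z :=
    (zpow_right_strictAnti₀ (zero_lt_iff.mpr hs0) hs).injective
  -- The terms of the equation of `b` have pairwise distinct values, so they cannot cancel.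
  obtain ⟨j, hj, hmax⟩ := Finset.exists_max_image χ.support
    (fun i => v ((χ.coeff i : Ω) * b ^ i)) (Polynomial.support_nonempty.mpr hχ)
  have hsum : v (∑ i ∈ χ.support, (χ.coeff i : Ω) * b ^ i) = v ((χ.coeff j : Ω) * b ^ j) := by
    classical
    refine v.map_sum_eq_of_lt hj fun i hi => ?_
    rw [Finset.mem_sdiff, Finset.mem_singleton] at hi
    refine lt_of_le_of_ne (hmax i hi.1) fun heq => hi.2 ?_
    obtain ⟨z, hz⟩ := hterm i hi.1
    obtain ⟨z', hz'⟩ := hterm j hj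
    rw [hz, hz'] at heq
    have h1 := hinj heq
    have hi' := Polynomial.le_natDegree_of_mem_supp i hi.1
    have hj' := Polynomial.le_natDegree_of_mem_supp j hj
    have h2 : (D : ℤ) ∣ (i : ℤ) - j := ⟨z - z', by linarith⟩
    have h3 := Int.eq_zero_of_abs_lt_dvd h2 (by rw [abs_lt]; omega)
    omega
  have hzero : ∑ i ∈ χ.support, (χ.coeff i : Ω) * b ^ i = 0 := by
    rw [← hroot, Polynomial.aeval_eq_sum_range,
      Finset.sum_subset (s₂ := Finset.range (χ.natDegree + 1))]
    · rfl
    · intro i hi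
      have := Polynomial.le_natDegree_of_mem_supp i hi
      simp only [Finset.mem_range]; omega
    · intro i _ hi
      rw [Polynomial.notMem_support_iff.mp hi]; simp
  rw [hzero, map_zero] at hsum
  obtain ⟨z, hz⟩ := hterm j hj
  rw [hz] at hsum
  exact zpow_ne_zero _ hs0 hsum.symm

section Growth

variable {φ : MvPolynomial (Fin 2) K ≃ₐ[K] MvPolynomial (Fin 2) K} {d : ℕ}
  {p : Fin 2 → K} {H : MvPolynomial (Fin 2) K}

/-- Once `d ^ n` exceeds the degree of a curve, its `n`-th preimage under a regular automorphism of
degree `d` meets the line at infinity at indeterminacy points only. Otherwise `φ ^ n` moves a place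
of the preimage to a place of the curve where a coordinate `x` has a pole of order divisible by
`d ^ n`, contradicting that the function field has degree at most that of the curve over `K(x)`. -/
theorem IsRegularWith.eval_eq_zero_of_lt_pow [Infinite K] (hφ : IsRegularWith φ d p H)
    {h : MvPolynomial (Fin 2) K} (hh : Irreducible h) {n : ℕ} (hn : h.totalDegree < d ^ n)
    {q : Fin 2 → K} (hq : q ≠ 0)
    (hqT : eval q (homogeneousComponent ((φ ^ n) h).totalDegree ((φ ^ n) h)) = 0) :
    eval q H = 0 := by
  by_contra hqH
  have hpos := totalDegree_pos_of_irreducible hh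
  obtain ⟨m, rfl⟩ : ∃ m, n = m + 1 := by
    cases n with
    | zero => simp at hn; omega
    | succ m => exact ⟨m, rfl⟩
  obtain ⟨Ω, _, _, Γ, _, v, hv, ξ, s, hξ, hlim⟩ :=
    exists_tendsToInfinity (algEquiv_irreducible (φ ^ (m + 1)) hh) hq hqT
  obtain ⟨c, hc, hlim'⟩ := hφ.map_pow m hlim hqH
  set ζ : Fin 2 → Ω := fun i => aeval ξ ((φ ^ (m + 1)) (X i)) with hζ
  have hζh : aeval ζ h = 0 := by rw [hζ, aeval_algEquiv_apply, hξ]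
  obtain ⟨k, hk⟩ := Function.ne_iff.mp hq
  obtain ⟨j, hj⟩ := Function.ne_iff.mp (smul_ne_zero hc hφ.ne_zero)
  have hb := hlim.valuation_mul_apply_eq_one hk
  have hx := hlim'.valuation_mul_apply_eq_one hj
  have hbζ : aeval ζ ((φ ^ (m + 1)).symm (X k)) = ξ k := by
    rw [hζ, aeval_algEquiv_apply]; simp
  obtain ⟨i, hcov, hij⟩ : ∃ i : Fin 2, (∀ l, l = j ∨ l = i) ∧ i ≠ j := by
    fin_cases j
    · exact ⟨1, by intro l; fin_cases l <;> simp, by simp⟩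
    · exact ⟨0, by intro l; fin_cases l <;> simp, by simp⟩
  set L := IntermediateField.adjoin K {ζ j} with hL
  set x' : L := ⟨ζ j, IntermediateField.mem_adjoin_simple_self K _⟩ with hx'
  have hDpos : d ^ (m + 1) ≠ 0 := by omega
  -- The equation of `ζ i` over `K(ζ j)`.
  let f : Fin 2 → Polynomial L := fun l => if l = j then Polynomial.C x' else Polynomial.X
  let χ : Polynomial L := aeval f h
  have hχdeg : χ.natDegree ≤ h.totalDegree := by
    have h1 := aeval_natDegree_le (n := 1) (MvPolynomial.map (algebraMap K L) h)
      (Finset.sup_mono (support_map_subset _ _)) f fun l => by by_cases hl : l = j <;> simp [f, hl]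
    rwa [aeval_map_algebraMap, mul_one] at h1
  have hχeval : ∀ {M : Type u} [Field M] [Algebra L M] [Algebra K M] [IsScalarTower K L M] (y : M),
      Polynomial.aeval y χ = aeval (fun l => if l = j then algebraMap L M x' else y) h := by
    intro M _ _ _ _ y
    have : ((Polynomial.aeval y).restrictScalars K).comp (aeval f) =
        (aeval (fun l => if l = j then algebraMap L M x' else y) :
          MvPolynomial (Fin 2) K →ₐ[K] M) := by
      ext l
      by_cases hl : l = j <;> simp [f, hl]
    rw [← this]; rfl
  have hxtr : Transcendental K (ζ j) := by
    have hv1 : 1 < v (ζ j) := by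
      by_contra! hle
      refine (mul_lt_one_of_lt_of_le ?_ hle).ne (by rw [← map_mul]; exact hx)
      exact hlim'.lt_one
    exact v.transcendental_of_ne_one K _ (by intro h0; rw [h0] at hv1; simp at hv1) hv1.ne'
  have hχ0 : χ ≠ 0 := by
    intro h0
    apply hh.ne_zero
    refine MvPolynomial.funext fun a => ?_
    have h1 := hχeval (M := Ω) (algebraMap K Ω (a i))
    rw [h0, map_zero] at h1
    let g : Polynomial K := aeval (fun l => if l = j then Polynomial.X else Polynomial.C (a i)) h
    have hg : ∀ {M : Type u} [CommRing M] [Algebra K M] (y : M), Polynomial.aeval y g =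
        aeval (fun l => if l = j then y else algebraMap K M (a i)) h := by
      intro M _ _ y
      rw [← AlgHom.comp_apply]
      congr 1
      ext l
      by_cases hl : l = j <;> simp [hl]
    have hg0 : g = 0 := by
      by_contra hg0
      exact hxtr ⟨g, hg0, (hg (ζ j)).trans h1.symm⟩
    have h2 := hg (a j)
    rw [hg0, map_zero] at h2
    rw [map_zero, ← aeval_eq_eval, h2]
    congr 2
    funext l
    rcases hcov l with rfl | rfl
    · simp
    · simp [hij]
  have hχroot : Polynomial.aeval (ζ i) χ = 0 := by
    rw [hχeval, ← hζh]
    congr 2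
    funext l
    rcases hcov l with rfl | rfl
    · simp [hx']
    · simp [hij]
  let F := IntermediateField.adjoin L {ζ i}
  have hmem : ∀ a : MvPolynomial (Fin 2) K, aeval ζ a ∈ F := by
    intro a
    induction a using MvPolynomial.induction_on with
    | C c =>
      have : aeval ζ (C c : MvPolynomial (Fin 2) K) = algebraMap L Ω (algebraMap K L c) := by
        rw [aeval_C]; rfl
      rw [this]
      exact F.algebraMap_mem _
    | add a b ha hb => rw [map_add]; exact F.add_mem ha hb
    | mul_X a l ha =>
      rw [map_mul, aeval_X]
      refine F.mul_mem ha ?_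
      rcases hcov l with rfl | rfl
      · exact F.algebraMap_mem x'
      · exact IntermediateField.mem_adjoin_simple_self L _
  obtain ⟨χ', hχ'0, hχ'root, hdeg⟩ :=
    exists_aeval_eq_zero_of_mem_adjoin hχ0 hχroot (hbζ ▸ hmem _ : ξ k ∈ F)
  have := le_of_valuation_eq (v := v) hlim.lt_one hDpos hx hb hχ'0 hχ'root
  omega

theorem IsRegularWith.exists_forall_le_totalDegree_pow [Infinite K] (hφ : IsRegularWith φ d p H)
    {h : MvPolynomial (Fin 2) K} (hh : Irreducible h) (B : ℕ) :
    ∃ n₀, ∀ n ≥ n₀, B ≤ ((φ ^ n) h).totalDegree := by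
  have hd := hφ.two_le
  obtain ⟨m, hm⟩ : ∃ m, h.totalDegree < d ^ m := ⟨_, Nat.lt_pow_self (by omega)⟩
  have hgrow : ∀ k, k + 1 ≤ ((φ ^ (m + k)) h).totalDegree := by
    intro k
    induction k with
    | zero => exact totalDegree_pos_of_irreducible (algEquiv_irreducible _ hh)
    | succ k ih =>
      have h1 := hφ.mul_totalDegree_le (w := (φ ^ (m + k)) h) fun h0 =>
        hφ.eval_ne_zero (hφ.eval_eq_zero_of_lt_pow hh
          (hm.trans_le (Nat.pow_le_pow_right (by omega) (by omega))) hφ.ne_zero h0)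
      have h2 : φ ((φ ^ (m + k)) h) = (φ ^ (m + (k + 1))) h := by
        rw [← add_assoc, pow_succ' φ]; rfl
      rw [h2] at h1
      nlinarith
  refine ⟨m + B, fun n hn => ?_⟩
  have := hgrow (n - m)
  rw [show m + (n - m) = n by omega] at this
  omega

end Growth

/-! ### Curves without common points at infinity -/

theorem exists_eval_eq_zero_of_isHomogeneous [IsAlgClosed K] {c : MvPolynomial (Fin 2) K} {k : ℕ}
    (hc : c.IsHomogeneous k) (hk : k ≠ 0) : ∃ q, q ≠ 0 ∧ eval q c = 0 := by
  have : Infinite K := IsAlgClosed.instInfinite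
  by_cases h0 : eval ![0, 1] c = 0
  · exact ⟨_, fun h => by simpa using congrFun h 1, h0⟩
  let χ : Polynomial K := aeval ![1, Polynomial.X] c
  have hχ : ∀ y, χ.eval y = eval ![1, y] c := by
    intro y
    rw [← Polynomial.coe_aeval_eq_eval, ← AlgHom.comp_apply, ← aeval_eq_eval]
    change _ = aeval ![1, y] c
    congr 1
    ext l; fin_cases l <;> simp
  by_cases hdeg : χ.degree = 0
  · -- The form is constant on the line `x = 1`, so it is a multiple of `x ^ k` and vanishes at
    -- the point `(0, 1)`.
    exfalso
    obtain ⟨κ, hκ⟩ : ∃ κ, χ = Polynomial.C κ := ⟨_, Polynomial.eq_C_of_degree_eq_zero hdeg⟩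
    rw [hκ] at hχ
    let θ : Polynomial K := aeval ![Polynomial.X, 1] c
    have hθ : ∀ y, θ.eval y = eval ![y, 1] c := by
      intro y
      rw [← Polynomial.coe_aeval_eq_eval, ← AlgHom.comp_apply, ← aeval_eq_eval]
      change _ = aeval ![y, 1] c
      congr 1
      ext l; fin_cases l <;> simp
    have heq : θ = Polynomial.C (κ) * Polynomial.X ^ k := by
      refine Polynomial.eq_of_infinite_eval_eq _ _ ?_
      refine Set.Infinite.mono ?_ (Set.finite_singleton (0 : K)).infinite_compl
      intro y hy
      have hy0 : y ≠ 0 := hy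
      have h1 : ![y, 1] = y • ![1, y⁻¹] := by
        ext l; fin_cases l <;> simp [hy0]
      change θ.eval y = _
      rw [hθ, h1, eval_smul_of_isHomogeneous hc, ← hχ]
      rw [Polynomial.eval_C, Polynomial.eval_mul, Polynomial.eval_C, Polynomial.eval_pow,
        Polynomial.eval_X, mul_comm]
    apply h0
    rw [← hθ, heq]
    simp [hk]
  · obtain ⟨y, hy⟩ := IsAlgClosed.exists_root χ hdeg
    refine ⟨![1, y], fun h => by simpa using congrFun h 0, ?_⟩
    rw [← hχ]; exact hy

/-- Binary forms without common zeros are relatively prime: the top form of a common divisor divides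
both of them, and it has a zero unless it is constant. -/
theorem isRelPrime_of_no_common_zero [IsAlgClosed K] {a b : MvPolynomial (Fin 2) K} {m n : ℕ}
    (ha : a.IsHomogeneous m) (hb : b.IsHomogeneous n) (ha0 : a ≠ 0) (hb0 : b ≠ 0)
    (hab : ∀ q, q ≠ 0 → eval q a = 0 → eval q b ≠ 0) : IsRelPrime a b := by
  intro c hca hcb
  have htop : ∀ {f : MvPolynomial (Fin 2) K} {l : ℕ}, f.IsHomogeneous l → f ≠ 0 → c ∣ f →
      homogeneousComponent c.totalDegree c ∣ f := by
    rintro f l hf hf0 ⟨e, rfl⟩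
    have hdeg := hf.totalDegree hf0
    rw [totalDegree_mul_of_isDomain (left_ne_zero_of_mul hf0) (right_ne_zero_of_mul hf0)] at hdeg
    refine ⟨homogeneousComponent e.totalDegree e, ?_⟩
    rw [← homogeneousComponent_add_mul le_rfl le_rfl, hdeg, homogeneousComponent_eq_self hf]
  have hc0 : c ≠ 0 := fun h => ha0 (by rwa [h, zero_dvd_iff] at hca)
  by_contra hunit
  have hcdeg : c.totalDegree ≠ 0 := by
    intro h
    refine hunit (isUnit_iff_totalDegree_of_isReduced.mpr ⟨?_, h⟩)
    rw [totalDegree_eq_zero_iff_eq_C] at h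
    rw [isUnit_iff_ne_zero]
    intro h1
    rw [h1, C_0] at h
    exact hc0 h
  obtain ⟨q, hq, hqc⟩ := exists_eval_eq_zero_of_isHomogeneous
    (homogeneousComponent_isHomogeneous c.totalDegree c) hcdeg
  have hz : ∀ {f : MvPolynomial (Fin 2) K}, homogeneousComponent c.totalDegree c ∣ f →
      eval q f = 0 := by
    rintro f ⟨e, rfl⟩
    rw [map_mul, hqc, zero_mul]
  exact hab q hq (hz (htop ha ha0 hca)) (hz (htop hb hb0 hcb))

/-- If the curves `w = 0` and `g = 0` have no common point at infinity, a polynomial in the ideal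
`(w, g)` but not in `(w)` has degree at least that of `g`: minimal representatives modulo `w`
cannot have their top forms cancelled. -/
theorem totalDegree_le_of_dvd_sub_mul [IsAlgClosed K] {w g f : MvPolynomial (Fin 2) K}
    (hw : w.totalDegree ≠ 0) (hg : g.totalDegree ≠ 0)
    (hwg : ∀ q, q ≠ 0 → eval q (homogeneousComponent w.totalDegree w) = 0 →
      eval q (homogeneousComponent g.totalDegree g) ≠ 0)
    (hf : ¬ w ∣ f) (r : MvPolynomial (Fin 2) K) (hr : w ∣ f - r * g) :
    g.totalDegree ≤ f.totalDegree := by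
  have hw0 : w ≠ 0 := by rintro rfl; simp at hw
  have hg0 : g ≠ 0 := by rintro rfl; simp at hg
  have hrel : IsRelPrime (homogeneousComponent w.totalDegree w)
      (homogeneousComponent g.totalDegree g) :=
    isRelPrime_of_no_common_zero (homogeneousComponent_isHomogeneous _ _)
      (homogeneousComponent_isHomogeneous _ _) (homogeneousComponent_totalDegree_ne_zero hw0)
      (homogeneousComponent_totalDegree_ne_zero hg0) hwg
  generalize hn : r.totalDegree = n
  induction n using Nat.strong_induction_on generalizing r with
  | _ n ih =>
  have hr0 : r ≠ 0 := by
    rintro rfl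
    rw [zero_mul, sub_zero] at hr
    exact hf hr
  have hrg := totalDegree_mul_of_isDomain hr0 hg0
  by_contra! hlt
  have hflt : f.totalDegree < (r * g).totalDegree := by omega
  have htop : homogeneousComponent w.totalDegree w ∣
      homogeneousComponent r.totalDegree r * homogeneousComponent g.totalDegree g := by
    obtain ⟨a, ha⟩ := hr
    have hsum : homogeneousComponent (r * g).totalDegree (w * a) =
        - homogeneousComponent (r * g).totalDegree (r * g) := by
      rw [← ha, map_sub, homogeneousComponent_eq_zero _ _ hflt, zero_sub]
    have hwa0 : w * a ≠ 0 := by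
      intro h
      rw [h, map_zero, zero_eq_neg] at hsum
      exact homogeneousComponent_totalDegree_ne_zero (mul_ne_zero hr0 hg0) hsum
    have hle : (w * a).totalDegree ≤ (r * g).totalDegree := by
      rw [← ha]
      exact (totalDegree_sub _ _).trans (max_le hflt.le le_rfl)
    have hge : (w * a).totalDegree = (r * g).totalDegree := by
      refine hle.antisymm ?_
      by_contra! h
      rw [homogeneousComponent_eq_zero _ _ h, eq_comm, neg_eq_zero] at hsum
      exact homogeneousComponent_totalDegree_ne_zero (mul_ne_zero hr0 hg0) hsum
    have hwadeg := totalDegree_mul_of_isDomain (left_ne_zero_of_mul hwa0) (right_ne_zero_of_mul hwa0)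
    rw [← homogeneousComponent_add_mul le_rfl le_rfl, ← hrg, ← dvd_neg, ← hsum, ← hge, hwadeg,
      homogeneousComponent_add_mul le_rfl le_rfl]
    exact dvd_mul_right _ _
  obtain ⟨e, he⟩ := hrel.dvd_of_dvd_mul_right htop
  have hrt0 := homogeneousComponent_totalDegree_ne_zero hr0
  have hedeg : r.totalDegree = w.totalDegree + e.totalDegree := by
    have h1 := (homogeneousComponent_isHomogeneous r.totalDegree r).totalDegree hrt0
    have h2 := (homogeneousComponent_isHomogeneous w.totalDegree w).totalDegree
      (homogeneousComponent_totalDegree_ne_zero hw0)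
    rw [he] at hrt0
    rw [he, totalDegree_mul_of_isDomain (left_ne_zero_of_mul hrt0) (right_ne_zero_of_mul hrt0),
      h2] at h1
    exact h1.symm
  have hcomp : homogeneousComponent r.totalDegree (r - w * e) = 0 := by
    rw [map_sub, sub_eq_zero]
    conv_rhs => rw [hedeg, homogeneousComponent_add_mul le_rfl le_rfl]
    have h1 : homogeneousComponent r.totalDegree (homogeneousComponent r.totalDegree r) =
        homogeneousComponent r.totalDegree r :=
      homogeneousComponent_eq_self (homogeneousComponent_isHomogeneous _ _)
    rw [← h1, he]
    conv_lhs => rw [hedeg, homogeneousComponent_add_mul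
      (homogeneousComponent_isHomogeneous w.totalDegree w).totalDegree_le le_rfl]
    rw [homogeneousComponent_eq_self (homogeneousComponent_isHomogeneous w.totalDegree w)]
  have hle : (r - w * e).totalDegree ≤ r.totalDegree :=
    (totalDegree_sub _ _).trans (max_le le_rfl ((totalDegree_mul _ _).trans hedeg.ge))
  have hlt' : (r - w * e).totalDegree < n := by
    rw [← hn]
    refine lt_of_le_of_ne hle fun heq => ?_
    by_cases h0 : r - w * e = 0
    · rw [h0, totalDegree_zero] at heq
      omega
    · rw [← heq] at hcomp
      exact homogeneousComponent_totalDegree_ne_zero h0 hcomp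
  have := ih _ hlt' (r - w * e) (by
    have : f - (r - w * e) * g = (f - r * g) + w * (e * g) := by ring
    rw [this]
    exact dvd_add hr (dvd_mul_right _ _)) rfl
  omega

section

variable {φ : MvPolynomial (Fin 2) K ≃ₐ[K] MvPolynomial (Fin 2) K} {d : ℕ}
  {p : Fin 2 → K} {H : MvPolynomial (Fin 2) K}

/-- The multiplicities of intersection of a curve with its iterates are unbounded: no function
nonzero on the curve lies in the ideals of infinitely many of these intersections. The proof moves
the intersections by a fixed iterate, which separates the points at infinity. -/
theorem IsRegularWith.exists_forall_notMem_span_pair [IsAlgClosed K] (hφ : IsRegularWith φ d p H)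
    {h : MvPolynomial (Fin 2) K} (hh : Irreducible h) {f : MvPolynomial (Fin 2) K}
    (hf : ¬ h ∣ f) : ∃ n₀, ∀ n ≥ n₀, f ∉ Ideal.span {h, (φ ^ n) h} := by
  have : Infinite K := IsAlgClosed.instInfinite
  obtain ⟨d', p', H', hψ, hpp, hH', hH⟩ := hφ.exists_symm
  have hd := hφ.two_le
  have hd' := hψ.two_le
  obtain ⟨m, hm⟩ : ∃ m, h.totalDegree < d' ^ m := ⟨_, Nat.lt_pow_self (by omega)⟩
  obtain ⟨k, hk⟩ : ∃ k, h.totalDegree < d ^ k := ⟨_, Nat.lt_pow_self (by omega)⟩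
  obtain ⟨n₁, hn₁⟩ := hφ.exists_forall_le_totalDegree_pow hh (((φ.symm ^ m) f).totalDegree + 1)
  refine ⟨m + k + n₁, fun n hn hmem => ?_⟩
  obtain ⟨l, rfl⟩ := Nat.exists_eq_add_of_le (show m ≤ n by omega)
  obtain ⟨a, r, har⟩ := Ideal.mem_span_pair.mp hmem
  have hback : (φ.symm ^ m) ((φ ^ (m + l)) h) = (φ ^ l) h := by
    have : φ.symm ^ m * φ ^ (m + l) = φ ^ l := by
      change φ⁻¹ ^ m * φ ^ (m + l) = φ ^ l
      rw [pow_add, inv_pow, inv_mul_cancel_left]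
    rw [← this]; rfl
  have hle := totalDegree_le_of_dvd_sub_mul (w := (φ.symm ^ m) h) (g := (φ ^ l) h)
    (f := (φ.symm ^ m) f)
    (totalDegree_pos_of_irreducible (algEquiv_irreducible _ hh)).ne'
    (totalDegree_pos_of_irreducible (algEquiv_irreducible _ hh)).ne'
    (fun q hq h1 h2 => hpp (parallel_trans hq
      (hH' q hq (hψ.eval_eq_zero_of_lt_pow hh hm hq h1))
      (hH q hq (hφ.eval_eq_zero_of_lt_pow hh
        (hk.trans_le (Nat.pow_le_pow_right (by omega) (by omega))) hq h2))))
    (fun hdvd => hf ((map_dvd_iff (φ.symm ^ m)).mp hdvd))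
    ((φ.symm ^ m) r) ⟨(φ.symm ^ m) a, by
      rw [← hback, ← map_mul, ← har, map_add, map_mul, map_mul]; ring⟩
  have := hn₁ l (by omega)
  omega

/-- A regular automorphism has no periodic curve. -/
theorem IsRegularWith.not_dvd_pow [Infinite K] (hφ : IsRegularWith φ d p H)
    {h : MvPolynomial (Fin 2) K} (hh : Irreducible h) {n : ℕ} (hn : n ≠ 0) :
    ¬ h ∣ (φ ^ n) h := by
  intro hdvd
  have hassoc : Associated h ((φ ^ n) h) :=
    hh.associated_of_dvd (algEquiv_irreducible _ hh) hdvd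
  have hdeg : ∀ {a b : MvPolynomial (Fin 2) K}, Associated a b → a ≠ 0 → b ≠ 0 →
      a.totalDegree = b.totalDegree := fun h ha hb =>
    (totalDegree_le_of_dvd_of_isDomain h.dvd hb).antisymm
      (totalDegree_le_of_dvd_of_isDomain h.symm.dvd ha)
  have hall : ∀ j, Associated h ((φ ^ (n * j)) h) := by
    intro j
    induction j with
    | zero => exact Associated.refl _
    | succ j ih =>
      refine hassoc.trans ?_
      have := ih.map (φ ^ n)
      rw [mul_add, mul_one, add_comm, pow_add]
      exact this
  obtain ⟨n₀, hn₀⟩ := hφ.exists_forall_le_totalDegree_pow hh (h.totalDegree + 1)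
  have h1 := hn₀ (n * n₀) (Nat.le_mul_of_pos_left _ (Nat.pos_of_ne_zero hn))
  have h2 := hdeg (hall n₀) hh.ne_zero (algEquiv_irreducible _ hh).ne_zero
  omega

end

/-! ### First-order behaviour at a fixed point -/

/-- The maximal ideal of the point `p`. -/
noncomputable def pointIdeal (p : Fin 2 → K) : Ideal (MvPolynomial (Fin 2) K) :=
  RingHom.ker (eval p)

theorem mem_pointIdeal {p : Fin 2 → K} {a : MvPolynomial (Fin 2) K} :
    a ∈ pointIdeal p ↔ eval p a = 0 := RingHom.mem_ker

/-- The gradient of a polynomial at the point `p`. -/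
noncomputable def gradientAt (p : Fin 2 → K) : MvPolynomial (Fin 2) K →ₗ[K] (Fin 2 → K) where
  toFun a i := eval p (pderiv i a)
  map_add' a b := by ext i; simp
  map_smul' c a := by ext i; simp [smul_eval]

theorem gradientAt_apply (p : Fin 2 → K) (a : MvPolynomial (Fin 2) K) (i : Fin 2) :
    gradientAt p a i = eval p (pderiv i a) := rfl

theorem gradientAt_mul (p : Fin 2 → K) (a b : MvPolynomial (Fin 2) K) :
    gradientAt p (a * b) = eval p b • gradientAt p a + eval p a • gradientAt p b := by
  ext i
  simp only [gradientAt_apply, pderiv_mul, map_add, map_mul, Pi.add_apply, Pi.smul_apply,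
    smul_eq_mul]
  ring

theorem gradientAt_X (p : Fin 2 → K) (i : Fin 2) : gradientAt p (X i) = Pi.single i 1 := by
  ext j
  rw [gradientAt_apply, pderiv_X, Pi.single_apply, Pi.single_apply]
  by_cases h : i = j
  · subst h; simp
  · have h' : j ≠ i := fun e => h e.symm
    simp [h, h']

theorem gradientAt_C (p : Fin 2 → K) (c : K) : gradientAt p (C c) = 0 := by
  ext i; simp [gradientAt_apply]

theorem sub_linear_part_mem_sq (p : Fin 2 → K) (a : MvPolynomial (Fin 2) K) :
    a - C (eval p a) - ∑ i, C (gradientAt p a i) * (X i - C (p i)) ∈ pointIdeal p ^ 2 := by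
  have hX : ∀ i, X i - C (p i) ∈ pointIdeal p := fun i => by rw [mem_pointIdeal]; simp
  induction a using MvPolynomial.induction_on with
  | C c =>
    simp [gradientAt_C]
  | add a b ha hb =>
    have := add_mem ha hb
    convert this using 1
    simp only [Fin.sum_univ_two, map_add, Pi.add_apply]
    ring
  | mul_X a i ha =>
    have h1 : gradientAt p (a * X i) =
        p i • gradientAt p a + eval p a • (Pi.single i 1 : Fin 2 → K) := by
      rw [gradientAt_mul, eval_X, gradientAt_X]
    have h2 : ∑ j, C (gradientAt p (a * X i) j) * (X j - C (p j)) =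
        C (p i) * (∑ j, C (gradientAt p a j) * (X j - C (p j))) +
        C (eval p a) * (X i - C (p i)) := by
      rw [h1]
      fin_cases i <;> simp [Fin.sum_univ_two] <;> ring
    have h3 : a * X i - C (eval p (a * X i)) -
        ∑ j, C (gradientAt p (a * X i) j) * (X j - C (p j)) =
        X i * (a - C (eval p a) - ∑ j, C (gradientAt p a j) * (X j - C (p j))) +
        (∑ j, C (gradientAt p a j) * (X j - C (p j))) * (X i - C (p i)) := by
      rw [h2, map_mul, eval_X, map_mul]
      ring
    rw [h3]
    refine add_mem (Ideal.mul_mem_left _ _ ha) ?_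
    rw [pow_two]
    exact Ideal.mul_mem_mul (sum_mem fun j _ => Ideal.mul_mem_left _ _ (hX j)) (hX i)

theorem mem_sq_of_gradientAt_eq_zero {p : Fin 2 → K} {a : MvPolynomial (Fin 2) K}
    (h0 : eval p a = 0) (h1 : gradientAt p a = 0) : a ∈ pointIdeal p ^ 2 := by
  simpa [h0, h1] using sub_linear_part_mem_sq p a

/-- The automorphism `θ` acts on polynomials preserving the values at `p`, that is, the
corresponding map of the plane fixes `p`. -/
def FixesPoint (θ : MvPolynomial (Fin 2) K ≃ₐ[K] MvPolynomial (Fin 2) K) (p : Fin 2 → K) : Prop :=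
  ∀ a, eval p (θ a) = eval p a

theorem FixesPoint.pow {θ : MvPolynomial (Fin 2) K ≃ₐ[K] MvPolynomial (Fin 2) K} {p : Fin 2 → K}
    (h : FixesPoint θ p) (n : ℕ) : FixesPoint (θ ^ n) p := by
  induction n with
  | zero => intro a; rfl
  | succ n ih =>
    intro a
    rw [pow_succ]
    exact (ih (θ a)).trans (h a)

/-- The transposed Jacobian matrix at `p` of the polynomial map with action `θ` on polynomials. -/
noncomputable def jacobianAt (p : Fin 2 → K)
    (θ : MvPolynomial (Fin 2) K ≃ₐ[K] MvPolynomial (Fin 2) K) : Matrix (Fin 2) (Fin 2) K :=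
  Matrix.of fun j i => gradientAt p (θ (X i)) j

theorem gradientAt_algEquiv {θ : MvPolynomial (Fin 2) K ≃ₐ[K] MvPolynomial (Fin 2) K}
    {p : Fin 2 → K} (h : FixesPoint θ p) (a : MvPolynomial (Fin 2) K) :
    gradientAt p (θ a) = (jacobianAt p θ).mulVec (gradientAt p a) := by
  induction a using MvPolynomial.induction_on with
  | C c =>
    have h1 : θ (C c) = C c := θ.commutes c
    rw [h1, gradientAt_C, Matrix.mulVec_zero]
  | add a b ha hb => rw [map_add, map_add, map_add, Matrix.mulVec_add, ha, hb]
  | mul_X a i ha =>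
    rw [map_mul, gradientAt_mul, gradientAt_mul, h, h, ha, Matrix.mulVec_add, Matrix.mulVec_smul,
      Matrix.mulVec_smul]
    congr 2
    rw [gradientAt_X, Matrix.mulVec_single_one]
    rfl

theorem jacobianAt_mul {θ θ' : MvPolynomial (Fin 2) K ≃ₐ[K] MvPolynomial (Fin 2) K}
    {p : Fin 2 → K} (h : FixesPoint θ p) :
    jacobianAt p (θ * θ') = jacobianAt p θ * jacobianAt p θ' := by
  ext j i
  change gradientAt p (θ (θ' (X i))) j = _
  rw [gradientAt_algEquiv h]
  rfl

theorem jacobianAt_one (p : Fin 2 → K) : jacobianAt p 1 = 1 := by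
  ext j i
  change gradientAt p (X i) j = _
  rw [gradientAt_X, Matrix.one_apply, Pi.single_apply]

theorem jacobianAt_pow {θ : MvPolynomial (Fin 2) K ≃ₐ[K] MvPolynomial (Fin 2) K}
    {p : Fin 2 → K} (h : FixesPoint θ p) (n : ℕ) :
    jacobianAt p (θ ^ n) = jacobianAt p θ ^ n := by
  induction n with
  | zero => rw [pow_zero, pow_zero, jacobianAt_one]
  | succ n ih => rw [pow_succ, pow_succ, jacobianAt_mul (h.pow n), ih]

/-! ### The finite difference operator of an automorphism -/

/-- The operator `θ - 1` on polynomials. -/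
noncomputable def differenceOp (θ : MvPolynomial (Fin 2) K ≃ₐ[K] MvPolynomial (Fin 2) K) :
    Module.End K (MvPolynomial (Fin 2) K) :=
  θ.toLinearMap - 1

section Difference

variable {θ : MvPolynomial (Fin 2) K ≃ₐ[K] MvPolynomial (Fin 2) K} {p : Fin 2 → K}

theorem differenceOp_apply (a : MvPolynomial (Fin 2) K) : differenceOp θ a = θ a - a := rfl

theorem differenceOp_mul (a b : MvPolynomial (Fin 2) K) :
    differenceOp θ (a * b) = differenceOp θ a * b + a * differenceOp θ b +
      differenceOp θ a * differenceOp θ b := by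
  simp only [differenceOp_apply, map_mul]; ring

theorem differenceOp_pow_mul_mem (I : Ideal (MvPolynomial (Fin 2) K)) (J : ℕ)
    (a b : MvPolynomial (Fin 2) K)
    (h : ∀ x y, J ≤ x + y → (differenceOp θ ^ x) a * (differenceOp θ ^ y) b ∈ I) :
    (differenceOp θ ^ J) (a * b) ∈ I := by
  induction J generalizing a b with
  | zero => simpa using h 0 0 le_rfl
  | succ J ih =>
    have hs : ∀ (x : ℕ) (c : MvPolynomial (Fin 2) K),
        (differenceOp θ ^ x) (differenceOp θ c) = (differenceOp θ ^ (x + 1)) c := fun x c => by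
      rw [pow_succ]; rfl
    rw [← hs, differenceOp_mul, map_add, map_add]
    refine add_mem (add_mem (ih _ _ fun x y hxy => ?_) (ih _ _ fun x y hxy => ?_))
      (ih _ _ fun x y hxy => ?_)
    · rw [hs]; exact h _ _ (by omega)
    · rw [hs]; exact h _ _ (by omega)
    · rw [hs, hs]; exact h _ _ (by omega)

theorem differenceOp_mem_pow (h : FixesPoint θ p) {k : ℕ} {a : MvPolynomial (Fin 2) K}
    (ha : a ∈ pointIdeal p ^ k) : differenceOp θ a ∈ pointIdeal p ^ k := by
  refine sub_mem ?_ ha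
  have h1 : Ideal.map θ.toRingEquiv.toRingHom (pointIdeal p) ≤ pointIdeal p := by
    rw [Ideal.map_le_iff_le_comap]
    intro b hb
    rw [Ideal.mem_comap, mem_pointIdeal]
    exact (h b).trans (mem_pointIdeal.mp hb)
  have h2 := Ideal.mem_map_of_mem θ.toRingEquiv.toRingHom ha
  rw [Ideal.map_pow] at h2
  exact Ideal.pow_right_mono h1 k h2

theorem differenceOp_pow_mem_pow (h : FixesPoint θ p) {k : ℕ} (j : ℕ)
    {a : MvPolynomial (Fin 2) K} (ha : a ∈ pointIdeal p ^ k) :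
    (differenceOp θ ^ j) a ∈ pointIdeal p ^ k := by
  induction j with
  | zero => simpa using ha
  | succ j ih =>
    rw [pow_succ', Module.End.mul_apply]
    exact differenceOp_mem_pow h ih

theorem differenceOp_sq_mem_sq (h : FixesPoint θ p)
    (hJ : (jacobianAt p θ - 1) * (jacobianAt p θ - 1) = 0) (a : MvPolynomial (Fin 2) K) :
    (differenceOp θ ^ 2) a ∈ pointIdeal p ^ 2 := by
  have h1 : ∀ b, gradientAt p (differenceOp θ b) = (jacobianAt p θ - 1).mulVec (gradientAt p b) :=
    fun b => by
      rw [differenceOp_apply, map_sub, gradientAt_algEquiv h, Matrix.sub_mulVec, Matrix.one_mulVec]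
  rw [pow_two (differenceOp θ), Module.End.mul_apply]
  refine mem_sq_of_gradientAt_eq_zero ?_ ?_
  · rw [differenceOp_apply, map_sub, h, sub_self]
  · rw [h1, h1, Matrix.mulVec_mulVec, hJ, Matrix.zero_mulVec]

/-- If the differential of `θ` at a fixed point is unipotent, `θ` acts unipotently on jets. -/
theorem differenceOp_pow_mem_pow_succ (h : FixesPoint θ p)
    (hJ : (jacobianAt p θ - 1) * (jacobianAt p θ - 1) = 0) (i : ℕ) :
    ∀ c ∈ pointIdeal p ^ (i + 1), (differenceOp θ ^ (2 * i + 2)) c ∈ pointIdeal p ^ (i + 2) := by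
  induction i with
  | zero => exact fun c _ => differenceOp_sq_mem_sq h hJ c
  | succ i ih =>
    intro c hc
    rw [pow_succ' (pointIdeal p) (i + 1)] at hc
    induction hc using Submodule.mul_induction_on' with
    | mem_mul_mem a ha b hb =>
      refine differenceOp_pow_mul_mem _ _ a b fun x y hxy => ?_
      by_cases hx : 2 ≤ x
      · rw [show i + 1 + 2 = 2 + (i + 1) by ring, pow_add]
        refine Ideal.mul_mem_mul ?_ (differenceOp_pow_mem_pow h y hb)
        obtain ⟨x', rfl⟩ := Nat.exists_eq_add_of_le' hx
        rw [pow_add (differenceOp θ), Module.End.mul_apply]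
        exact differenceOp_pow_mem_pow h x' (differenceOp_sq_mem_sq h hJ a)
      · rw [show i + 1 + 2 = 1 + (i + 2) by ring, pow_add _ 1, pow_one]
        obtain ⟨y', rfl⟩ := Nat.exists_eq_add_of_le' (show 2 * i + 2 ≤ y by omega)
        refine Ideal.mul_mem_mul ?_ ?_
        · have := differenceOp_pow_mem_pow h x (k := 1) (by rwa [pow_one])
          rwa [pow_one] at this
        · rw [pow_add (differenceOp θ), Module.End.mul_apply]
          exact differenceOp_pow_mem_pow h y' (ih b hb)
    | add a _ b _ ha hb => rw [map_add]; exact add_mem ha hb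

theorem exists_forall_differenceOp_pow_mem (h : FixesPoint θ p)
    (hJ : (jacobianAt p θ - 1) * (jacobianAt p θ - 1) = 0) {a : MvPolynomial (Fin 2) K}
    (ha : a ∈ pointIdeal p) (k : ℕ) :
    ∃ J, ∀ j ≥ J, (differenceOp θ ^ j) a ∈ pointIdeal p ^ k := by
  suffices ∃ J, (differenceOp θ ^ J) a ∈ pointIdeal p ^ (k + 1) by
    obtain ⟨J, hJk⟩ := this
    refine ⟨J, fun j hj => ?_⟩
    obtain ⟨l, rfl⟩ := Nat.exists_eq_add_of_le' hj
    rw [pow_add (differenceOp θ), Module.End.mul_apply]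
    exact differenceOp_pow_mem_pow h l (Ideal.pow_le_pow_right (Nat.le_succ k) hJk)
  induction k with
  | zero => exact ⟨0, by simpa using ha⟩
  | succ k ih =>
    obtain ⟨J, hJk⟩ := ih
    refine ⟨2 * k + 2 + J, ?_⟩
    rw [pow_add (differenceOp θ), Module.End.mul_apply]
    exact differenceOp_pow_mem_pow_succ h hJ k _ hJk

/-- Modulo a power of the maximal ideal, the iterates of a function under an automorphism with
unipotent differential depend polynomially on the exponent. So if the first iterate is not in an
ideal `W` containing this power, almost all iterates are not. -/
theorem eventually_pow_apply_notMem [CharZero K] (h : FixesPoint θ p)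
    (hJ : (jacobianAt p θ - 1) * (jacobianAt p θ - 1) = 0) {a : MvPolynomial (Fin 2) K}
    (ha : a ∈ pointIdeal p) {k : ℕ} {W : Ideal (MvPolynomial (Fin 2) K)}
    (hW : pointIdeal p ^ k ≤ W) (haW : θ a ∉ W) :
    ∀ᶠ n in Filter.atTop, (θ ^ n) a ∉ W := by
  classical
  obtain ⟨J, hJk⟩ := exists_forall_differenceOp_pow_mem h hJ ha k
  obtain ⟨L, hL, hLW⟩ := Submodule.exists_le_ker_of_notMem (K := K)
    (p := W.restrictScalars K) (v := θ a) haW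
  have hL0 : ∀ b ∈ W, L b = 0 := fun b hb => hLW hb
  let Q : Polynomial K := ∑ j ∈ Finset.range J,
    Polynomial.C (L ((differenceOp θ ^ j) a) / (j.factorial : K)) * descPochhammer K j
  have hQ : ∀ n : ℕ, Q.eval (n : K) = L ((θ ^ n) a) := by
    intro n
    have hθn : ∀ n : ℕ, ∀ b, (θ ^ n) b = ((differenceOp θ + 1) ^ n) b := by
      intro n
      induction n with
      | zero => intro b; rfl
      | succ n ih =>
        intro b
        rw [pow_succ, pow_succ]
        refine (ih (θ b)).trans ?_
        change _ = ((differenceOp θ + 1) ^ n) ((differenceOp θ + 1) b)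
        congr 1
        change θ b = (θ b - b) + b
        ring
    rw [hθn, (Commute.one_right (differenceOp θ)).add_pow, LinearMap.sum_apply, map_sum,
      Polynomial.eval_finsetSum]
    have hterm : ∀ j, L ((differenceOp θ ^ j * 1 ^ (n - j) *
        (n.choose j : Module.End K (MvPolynomial (Fin 2) K))) a) =
        (n.choose j : K) * L ((differenceOp θ ^ j) a) := by
      intro j
      rw [one_pow, mul_one, ← nsmul_eq_mul', LinearMap.smul_apply, map_nsmul, nsmul_eq_mul]
    simp only [hterm]
    have hQterm : ∀ j, (Polynomial.C (L ((differenceOp θ ^ j) a) / (j.factorial : K)) *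
        descPochhammer K j).eval (n : K) = (n.choose j : K) * L ((differenceOp θ ^ j) a) := by
      intro j
      rw [Polynomial.eval_mul, Polynomial.eval_C, Nat.cast_choose_eq_descPochhammer_div]
      ring
    simp only [hQterm]
    refine (Finset.sum_subset (Finset.range_mono (le_max_left J (n + 1))) ?_).trans
      (Finset.sum_subset (Finset.range_mono (le_max_right J (n + 1))) ?_).symm
    · intro j _ hj
      rw [hL0 _ (hW (hJk j (by simpa using hj))), mul_zero]
    · intro j _ hj
      rw [Nat.choose_eq_zero_of_lt (by simpa using hj)]; simp
  have hQ0 : Q ≠ 0 := by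
    intro h0
    have := hQ 1
    rw [h0, pow_one, Polynomial.eval_zero] at this
    exact hL this.symm
  have hfin : Set.Finite {n : ℕ | (θ ^ n) a ∈ W} := by
    refine Set.Finite.subset (Set.Finite.preimage (f := fun n : ℕ => (n : K))
      Nat.cast_injective.injOn (Q.roots.toFinset.finite_toSet)) fun n hn => ?_
    simp only [Set.mem_preimage, Finset.mem_coe, Multiset.mem_toFinset,
      Polynomial.mem_roots hQ0, Polynomial.IsRoot]
    rw [hQ, hL0 _ hn]
  rw [← Nat.cofinite_eq_atTop]
  exact hfin.eventually_cofinite_notMem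

end Difference

/-! ### Intersection multiplicities at a point -/

theorem exists_eq_smul_add_smul {v w : Fin 2 → K} (h : v 0 * w 1 - v 1 * w 0 ≠ 0)
    (x : Fin 2 → K) : ∃ α β : K, x = α • v + β • w := by
  refine ⟨(x 0 * w 1 - x 1 * w 0) / (v 0 * w 1 - v 1 * w 0),
    (v 0 * x 1 - v 1 * x 0) / (v 0 * w 1 - v 1 * w 0), ?_⟩
  ext i
  simp only [Pi.add_apply, Pi.smul_apply, smul_eq_mul]
  rw [div_mul_eq_mul_div, div_mul_eq_mul_div, ← add_div, eq_div_iff h]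
  fin_cases i <;> simp only [Fin.zero_eta, Fin.mk_one] <;> ring

theorem exists_eq_smul_of_det_eq_zero {v w : Fin 2 → K} (hv : v ≠ 0)
    (h : v 0 * w 1 - v 1 * w 0 = 0) : ∃ c : K, w = c • v := by
  obtain ⟨i, hi⟩ := Function.ne_iff.mp hv
  simp only [Pi.zero_apply] at hi
  refine ⟨w i / v i, ?_⟩
  ext j
  rw [Pi.smul_apply, smul_eq_mul, div_mul_eq_mul_div, eq_div_iff hi]
  fin_cases i <;> fin_cases j <;> simp only [Fin.zero_eta, Fin.mk_one]
  · linear_combination h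
  · linear_combination -h

section Local

variable {p : Fin 2 → K}

/-- Two curves crossing transversally at `p` generate its maximal ideal locally. -/
theorem exists_mul_mem_span_pair {a b : MvPolynomial (Fin 2) K}
    (ha : eval p a = 0) (hb : eval p b = 0)
    (h : gradientAt p a 0 * gradientAt p b 1 - gradientAt p a 1 * gradientAt p b 0 ≠ 0) :
    ∃ s, eval p s ≠ 0 ∧ ∀ x, eval p x = 0 → s * x ∈ Ideal.span {a, b} := by
  have hfg : (pointIdeal p).FG := IsNoetherian.noetherian _
  have hle : pointIdeal p ≤ Ideal.span {a, b} ⊔ pointIdeal p • pointIdeal p := by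
    intro x hx
    obtain ⟨α, β, hαβ⟩ := exists_eq_smul_add_smul h (gradientAt p x)
    have h1 : x - (α • a + β • b) ∈ pointIdeal p ^ 2 := by
      refine mem_sq_of_gradientAt_eq_zero ?_ ?_
      · rw [mem_pointIdeal] at hx
        simp [smul_eval, hx, ha, hb]
      · rw [map_sub, hαβ, map_add, map_smul, map_smul, sub_self]
    refine Submodule.mem_sup.mpr ⟨α • a + β • b, ?_, _, ?_, add_sub_cancel _ _⟩
    · rw [smul_eq_C_mul, smul_eq_C_mul]
      exact Ideal.mem_span_pair.mpr ⟨_, _, rfl⟩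
    · rwa [smul_eq_mul, ← pow_two]
  obtain ⟨s, hs, hs'⟩ := Submodule.exists_sub_one_mem_and_smul_le_of_fg_of_le_sup hfg le_rfl hle
  refine ⟨s, ?_, fun x hx => hs' (Submodule.smul_mem_pointwise_smul x s _ (mem_pointIdeal.mpr hx))⟩
  rw [mem_pointIdeal, map_sub, map_one, sub_eq_zero] at hs
  rw [hs]
  exact one_ne_zero

/-- Along a curve smooth at `p`, the local ring is a discrete valuation ring: a function of
valuation less than `k` divides the `k`-th power of every function vanishing at `p`. -/
theorem exists_mul_pow_mem_span_pair {h g : MvPolynomial (Fin 2) K} {k : ℕ}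
    (hp : eval p h = 0) (hsmooth : gradientAt p h ≠ 0)
    (hg : g ∉ Ideal.span {h} ⊔ pointIdeal p ^ k) :
    ∃ t, eval p t ≠ 0 ∧ ∀ q, eval p q = 0 → t * q ^ k ∈ Ideal.span {h, g} := by
  obtain ⟨e, he, hdet⟩ : ∃ e, eval p e = 0 ∧
      gradientAt p h 0 * gradientAt p e 1 - gradientAt p h 1 * gradientAt p e 0 ≠ 0 := by
    obtain ⟨i, hi⟩ := Function.ne_iff.mp hsmooth
    fin_cases i
    · refine ⟨X 1 - C (p 1), by simp, ?_⟩
      simpa [gradientAt_apply, pderiv_X] using hi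
    · refine ⟨X 0 - C (p 0), by simp, ?_⟩
      simpa [gradientAt_apply, pderiv_X] using hi
  obtain ⟨s, hs, hse⟩ := exists_mul_mem_span_pair hp he hdet
  classical
  have hnotk : ¬ ∃ r, eval p r ≠ 0 ∧ r * g ∈ Ideal.span {h, e ^ k} := by
    rintro ⟨r, hr, hrg⟩
    apply hg
    have hle : Ideal.span {h, e ^ k} ≤ Ideal.span {h} ⊔ pointIdeal p ^ k := by
      rw [Ideal.span_insert]
      refine sup_le_sup_left ?_ _
      rw [Ideal.span_singleton_le_iff_mem]
      exact Ideal.pow_mem_pow (mem_pointIdeal.mpr he) k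
    have hcop : IsCoprime (Ideal.span {r}) (pointIdeal p ^ k) := by
      refine IsCoprime.pow_right ?_
      rw [Ideal.isCoprime_iff_exists]
      refine ⟨C (eval p r)⁻¹ * r, Ideal.mul_mem_left _ _ (Ideal.mem_span_singleton_self r),
        1 - C (eval p r)⁻¹ * r, ?_, by ring⟩
      rw [mem_pointIdeal]
      simp [hr]
    obtain ⟨y, hy, z, hz, hyz⟩ := (Ideal.isCoprime_iff_exists).mp hcop
    obtain ⟨c, rfl⟩ := Ideal.mem_span_singleton'.mp hy
    have : g = c * (r * g) + g * z := by linear_combination -g * hyz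
    rw [this]
    exact add_mem (Ideal.mul_mem_left _ _ (hle hrg))
      (Ideal.mul_mem_left _ _ (Ideal.mem_sup_right hz))
  have hnot : ∃ j, ¬ ∃ r, eval p r ≠ 0 ∧ r * g ∈ Ideal.span {h, e ^ j} := ⟨k, hnotk⟩
  have hfind := Nat.find_spec hnot
  have hmin : ∀ j, j < Nat.find hnot → ∃ r, eval p r ≠ 0 ∧ r * g ∈ Ideal.span {h, e ^ j} :=
    fun j hj => not_not.mp (Nat.find_min hnot hj)
  have hk : Nat.find hnot ≤ k := Nat.find_min' hnot hnotk
  obtain ⟨j, hj⟩ : ∃ j, Nat.find hnot = j + 1 := by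
    refine Nat.exists_eq_succ_of_ne_zero fun h0 => ?_
    rw [h0] at hfind
    exact hfind ⟨1, by simp, by simp [Ideal.mem_span_pair]; exact ⟨0, g, by simp⟩⟩
  rw [hj] at hfind
  -- The valuation of `g` along the curve is `j`.
  obtain ⟨r, hr, hrg⟩ := hmin j (by omega)
  obtain ⟨a, b, hab⟩ := Ideal.mem_span_pair.mp hrg
  have hb : eval p b ≠ 0 := by
    intro hb0
    obtain ⟨c, d, hcd⟩ := Ideal.mem_span_pair.mp (hse b hb0)
    refine hfind ⟨s * r, by rw [map_mul]; exact mul_ne_zero hs hr,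
      Ideal.mem_span_pair.mpr ⟨s * a + c * e ^ j, d, ?_⟩⟩
    linear_combination s * hab + e ^ j * hcd
  refine ⟨b * s ^ k, by rw [map_mul, map_pow]; exact mul_ne_zero hb (pow_ne_zero _ hs), fun q hq => ?_⟩
  obtain ⟨c, d, hcd⟩ := Ideal.mem_span_pair.mp (hse q hq)
  obtain ⟨l, rfl⟩ := Nat.exists_eq_add_of_le (show j ≤ k by omega)
  obtain ⟨y, hy⟩ : h ∣ (s * q) ^ j - (d * e) ^ j := by
    refine dvd_trans ⟨c, ?_⟩ (sub_dvd_pow_sub_pow _ _ j)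
    linear_combination -hcd
  refine Ideal.mem_span_pair.mpr
    ⟨b * y * (s * q) ^ l - d ^ j * a * (s * q) ^ l, d ^ j * r * (s * q) ^ l, ?_⟩
  have e1 : b * s ^ (j + l) * q ^ (j + l) = b * (s * q) ^ j * (s * q) ^ l := by
    rw [mul_pow, mul_pow, pow_add, pow_add]; ring
  rw [e1]
  rw [mul_pow d e] at hy
  linear_combination (-b * (s * q) ^ l) * hy - d ^ j * (s * q) ^ l * hab

/-- A function not in the ideal of an irreducible curve through `p` is not in its sum with some
power of the maximal ideal, by Krull's intersection theorem. -/
theorem exists_notMem_sup_pow {h g : MvPolynomial (Fin 2) K} (hh : Irreducible h)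
    (hp : eval p h = 0) (hg : ¬ h ∣ g) : ∃ k, g ∉ Ideal.span {h} ⊔ pointIdeal p ^ k := by
  have hprime : (Ideal.span {h}).IsPrime :=
    (Ideal.span_singleton_prime hh.ne_zero).mpr hh.prime
  let mk := Ideal.Quotient.mk (Ideal.span {h})
  have htop : (pointIdeal p).map mk ≠ ⊤ := by
    intro ht
    have h1 : (1 : MvPolynomial (Fin 2) K ⧸ Ideal.span {h}) ∈ (pointIdeal p).map mk := by
      rw [ht]; trivial
    obtain ⟨x, hx, hx1⟩ := (Ideal.mem_map_iff_of_surjective mk Ideal.Quotient.mk_surjective).mp h1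
    rw [← map_one mk, Ideal.Quotient.eq, Ideal.mem_span_singleton] at hx1
    obtain ⟨c, hc⟩ := hx1
    have := congrArg (eval p) hc
    rw [map_sub, map_mul, hp, mem_pointIdeal.mp hx] at this
    simp at this
  have hbot := Ideal.iInf_pow_eq_bot_of_isDomain _ htop
  by_contra! hall
  apply hg
  rw [← Ideal.mem_span_singleton, ← Ideal.Quotient.eq_zero_iff_mem, ← Ideal.mem_bot, ← hbot,
    Ideal.mem_iInf]
  intro k
  rw [← Ideal.map_pow]
  obtain ⟨x, hx, y, hy, hxy⟩ := Submodule.mem_sup.mp (hall k)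
  rw [← hxy, map_add, Ideal.Quotient.eq_zero_iff_mem.mpr hx, zero_add]
  exact Ideal.mem_map_of_mem mk hy

/-- An involution with trivial differential at a fixed point is the identity. -/
theorem eq_one_of_jacobianAt_eq_one [CharZero K]
    {s : MvPolynomial (Fin 2) K ≃ₐ[K] MvPolynomial (Fin 2) K} (hs : FixesPoint s p)
    (hss : s * s = 1) (hJ : jacobianAt p s = 1) : s = 1 := by
  have hsq : ∀ a, differenceOp s a ∈ pointIdeal p ^ 2 := fun a => by
    refine mem_sq_of_gradientAt_eq_zero ?_ ?_
    · rw [differenceOp_apply, map_sub, hs, sub_self]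
    · rw [differenceOp_apply, map_sub, gradientAt_algEquiv hs, hJ, Matrix.one_mulVec, sub_self]
  have hraise : ∀ k, ∀ c ∈ pointIdeal p ^ k, differenceOp s c ∈ pointIdeal p ^ (k + 1) := by
    intro k
    induction k with
    | zero => exact fun c _ => Ideal.pow_le_pow_right (by omega) (hsq c)
    | succ k ih =>
      intro c hc
      rw [pow_succ' (pointIdeal p) k] at hc
      induction hc using Submodule.mul_induction_on' with
      | mem_mul_mem a ha b hb =>
        have hb' := ih b hb
        rw [differenceOp_mul]
        refine add_mem (add_mem ?_ ?_) ?_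
        · rw [show k + 1 + 1 = 2 + k by ring, pow_add]
          exact Ideal.mul_mem_mul (hsq a) hb
        · rw [pow_succ']
          exact Ideal.mul_mem_mul ha hb'
        · rw [pow_succ']
          exact Ideal.mul_mem_mul (Ideal.pow_le_self two_ne_zero (hsq a)) hb'
      | add a _ b _ ha hb => rw [map_add]; exact add_mem ha hb
  -- The square of `1 + δ` being `1`, the operator `δ` doubles `δ a` up to sign.
  have hneg : ∀ a, differenceOp s (differenceOp s a) = -2 * differenceOp s a := fun a => by
    have h1 : s (s a) = a := by
      have := congrArg (fun e => e a) hss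
      exact this
    simp only [differenceOp_apply, map_sub, h1]; ring
  have hall : ∀ a k, differenceOp s a ∈ pointIdeal p ^ k := by
    intro a k
    induction k with
    | zero => simp
    | succ k ih =>
      have h1 := hraise k _ ih
      rw [hneg] at h1
      have h2 := Ideal.mul_mem_left _ (C (-2 : K)⁻¹) h1
      have h3 : C (-2 : K)⁻¹ * (-2 * differenceOp s a) = differenceOp s a := by
        have : (-2 : MvPolynomial (Fin 2) K) = C (-2 : K) := by
          rw [map_neg, ← map_ofNat (C : K →+* MvPolynomial (Fin 2) K) 2]
        rw [this, ← mul_assoc, ← C_mul, inv_mul_cancel₀ (by norm_num), C_1, one_mul]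
      rwa [h3] at h2
  have htop : pointIdeal p ≠ ⊤ := by
    rw [Ideal.ne_top_iff_one, mem_pointIdeal, map_one]
    exact one_ne_zero
  ext1 a
  have h1 : differenceOp s a ∈ (⨅ k, pointIdeal p ^ k : Ideal _) :=
    Ideal.mem_iInf.mpr fun k => hall _ k
  rw [Ideal.iInf_pow_eq_bot_of_isDomain _ htop, Ideal.mem_bot, differenceOp_apply, sub_eq_zero] at h1
  exact h1

end Local

/-! ### Reversibility at a fixed point of the involution -/

theorem mul_pow_mul_pow_eq_one {G : Type*} [Group G] {s g : G} (hs : s * s = 1)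
    (h : s * g * s * g = 1) (n : ℕ) : s * g ^ n * s * g ^ n = 1 := by
  have hs' : s⁻¹ = s := inv_eq_of_mul_eq_one_left hs
  have h1 : s * g * s⁻¹ = g⁻¹ := by rw [hs']; exact eq_inv_of_mul_eq_one_left h
  have h2 : s * g ^ n * s⁻¹ = (g ^ n)⁻¹ := by rw [← conj_pow, h1, inv_pow]
  rw [hs'] at h2
  rw [h2, inv_mul_cancel]

theorem mulVec_eq_self_and_det_eq_one {B S : Matrix (Fin 2) (Fin 2) K} (hS : S * S = 1)
    (hR : S * B * S * B = 1) {v : Fin 2 → K} (hv : v ≠ 0) {ε c : K}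
    (hSv : S.mulVec v = ε • v) (hBv : B.mulVec v = c • v) :
    (B * B).mulVec v = v ∧ (B * B).det = 1 := by
  have hcancel : ∀ {x y : K}, x • v = y • v → x = y := fun h => smul_left_injective K hv h
  have hε : ε * ε = 1 := by
    apply hcancel
    have h1 : (S * S).mulVec v = v := by rw [hS, Matrix.one_mulVec]
    rw [← Matrix.mulVec_mulVec, hSv, Matrix.mulVec_smul, hSv, smul_smul] at h1
    rw [h1, one_smul]
  have hc : ε * c * (ε * c) = 1 := by
    have h1 : (S * B * S * B).mulVec v = v := by rw [hR, Matrix.one_mulVec]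
    simp only [← Matrix.mulVec_mulVec, hSv, hBv, Matrix.mulVec_smul, smul_smul] at h1
    have h2 := hcancel (h1.trans (one_smul K v).symm)
    linear_combination h2
  refine ⟨?_, ?_⟩
  · rw [← Matrix.mulVec_mulVec, hBv, Matrix.mulVec_smul, hBv, smul_smul]
    have : c * c = 1 := by linear_combination hc - c * c * hε
    rw [this, one_smul]
  · have h1 := congrArg Matrix.det hR
    have h2 := congrArg Matrix.det hS
    simp only [Matrix.det_mul, Matrix.det_one] at h1 h2 ⊢
    linear_combination h1 - B.det * B.det * h2

theorem sub_one_mul_self_eq_zero {M : Matrix (Fin 2) (Fin 2) K} {v : Fin 2 → K} (hv : v ≠ 0)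
    (hMv : M.mulVec v = v) (hdet : M.det = 1) : (M - 1) * (M - 1) = 0 := by
  rw [Matrix.det_fin_two] at hdet
  have h0 := congrFun hMv 0
  have h1 := congrFun hMv 1
  simp only [Matrix.mulVec, dotProduct, Fin.sum_univ_two] at h0 h1
  have htr : M 0 0 + M 1 1 = 2 := by
    obtain ⟨i, hi⟩ := Function.ne_iff.mp hv
    fin_cases i
    · refine mul_left_cancel₀ hi ?_
      simp only [Fin.zero_eta]
      linear_combination (v 0) * hdet + (1 - M 1 1) * h0 + M 0 1 * h1
    · refine mul_left_cancel₀ hi ?_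
      simp only [Fin.mk_one]
      linear_combination (v 1) * hdet + (1 - M 0 0) * h1 + M 1 0 * h0
  ext i j
  fin_cases i <;> fin_cases j <;>
    simp [Matrix.mul_apply, Fin.sum_univ_two]
  · linear_combination (M 0 0) * htr - hdet
  · linear_combination (M 0 1) * htr
  · linear_combination (M 1 0) * htr
  · linear_combination (M 1 1) * htr - hdet

/-- Let `φ ^ m` fix a point `p` of a curve fixed by the involution `s` reversing `φ`. Along the
multiples of some period, the intersection multiplicities at `p` of the curve and its iterates
are bounded: either the iterates are all transverse to the curve, or the tangent direction, being
fixed by `s`, is an eigenvector with eigenvalue `±1` and a further iterate is unipotent. -/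
theorem exists_forall_dvd_eventually [CharZero K]
    {φ s : MvPolynomial (Fin 2) K ≃ₐ[K] MvPolynomial (Fin 2) K} {h : MvPolynomial (Fin 2) K}
    {p : Fin 2 → K} {m : ℕ} (hm : m ≠ 0) (hφp : FixesPoint (φ ^ m) p) (hsp : FixesPoint s p)
    (hs : s * s = 1) (hrev : s * φ * s * φ = 1) (hh : Irreducible h) (hp : eval p h = 0)
    {c : K} (hsh : s h = C c * h) (hsmooth : gradientAt p h ≠ 0)
    (hper : ∀ n, n ≠ 0 → ¬ h ∣ (φ ^ n) h) :
    ∃ N, N ≠ 0 ∧ ∀ N', N' ≠ 0 → N ∣ N' → ∃ M, ∀ᶠ n in Filter.atTop, ∃ t, eval p t ≠ 0 ∧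
      ∀ q, eval p q = 0 → t * q ^ M ∈ Ideal.span {h, (φ ^ (N' * n)) h} := by
  have hφp' : ∀ l, FixesPoint (φ ^ (m * l)) p := fun l => by rw [pow_mul]; exact hφp.pow l
  by_cases htrans : ∃ l, l ≠ 0 ∧ gradientAt p h 0 * gradientAt p ((φ ^ (m * l)) h) 1 -
      gradientAt p h 1 * gradientAt p ((φ ^ (m * l)) h) 0 = 0
  · obtain ⟨l, hl, hdet⟩ := htrans
    obtain ⟨b, hb⟩ := exists_eq_smul_of_det_eq_zero hsmooth hdet
    rw [gradientAt_algEquiv (hφp' l)] at hb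
    have hSv : (jacobianAt p s).mulVec (gradientAt p h) = c • gradientAt p h := by
      rw [← gradientAt_algEquiv hsp, hsh, ← smul_eq_C_mul, map_smul]
    have hS : jacobianAt p s * jacobianAt p s = 1 := by
      rw [← jacobianAt_mul hsp, hs, jacobianAt_one]
    have hR : jacobianAt p s * jacobianAt p (φ ^ (m * l)) * jacobianAt p s *
        jacobianAt p (φ ^ (m * l)) = 1 := by
      have h1 : FixesPoint (s * φ ^ (m * l)) p := fun a => (hsp _).trans (hφp' l a)
      have h2 : FixesPoint (s * φ ^ (m * l) * s) p := fun a => (h1 _).trans (hsp a)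
      rw [← jacobianAt_mul hsp, ← jacobianAt_mul h1, ← jacobianAt_mul h2,
        mul_pow_mul_pow_eq_one hs hrev, jacobianAt_one]
    obtain ⟨hv, hd⟩ := mulVec_eq_self_and_det_eq_one hS hR hsmooth hSv hb
    refine ⟨m * l * 2, by positivity, ?_⟩
    rintro _ hN' ⟨k, rfl⟩
    have hfix : FixesPoint (φ ^ (m * l * 2 * k)) p := by
      rw [mul_assoc, mul_assoc]; exact hφp' _
    have hjac : jacobianAt p (φ ^ (m * l * 2 * k)) =
        (jacobianAt p (φ ^ (m * l)) * jacobianAt p (φ ^ (m * l))) ^ k := by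
      rw [pow_mul φ (m * l * 2), pow_mul φ (m * l) 2,
        jacobianAt_pow ((hφp' l).pow 2), jacobianAt_pow (hφp' l), pow_two]
    have hunip : (jacobianAt p (φ ^ (m * l * 2 * k)) - 1) *
        (jacobianAt p (φ ^ (m * l * 2 * k)) - 1) = 0 := by
      rw [hjac]
      refine sub_one_mul_self_eq_zero hsmooth ?_ (by rw [Matrix.det_pow, hd, one_pow])
      clear hN' hfix hjac
      induction k with
      | zero => rw [pow_zero, Matrix.one_mulVec]
      | succ k ih => rw [pow_succ, ← Matrix.mulVec_mulVec, hv, ih]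
    obtain ⟨M, hM⟩ := exists_notMem_sup_pow hh hp (hper _ hN')
    refine ⟨M, ?_⟩
    filter_upwards [eventually_pow_apply_notMem hfix hunip (mem_pointIdeal.mpr hp)
      le_sup_right hM] with n hn
    rw [← pow_mul] at hn
    exact exists_mul_pow_mem_span_pair hp hsmooth hn
  · push Not at htrans
    refine ⟨m, hm, ?_⟩
    rintro _ hN' ⟨k, rfl⟩
    refine ⟨1, ?_⟩
    filter_upwards [Filter.eventually_ne_atTop 0] with n hn
    have hk : k ≠ 0 := right_ne_zero_of_mul hN'
    have h1 := htrans (k * n) (mul_ne_zero hk hn)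
    rw [← mul_assoc] at h1
    obtain ⟨t, ht, htq⟩ := exists_mul_mem_span_pair hp (b := (φ ^ (m * k * n)) h)
      (by rw [mul_assoc, hφp', hp]) h1
    exact ⟨t, ht, fun q hq => by rw [pow_one]; exact htq q hq⟩

/-! ### Curves fixed by the involution -/

theorem dvd_of_forall_eval_eq_zero [IsAlgClosed K] {h g : MvPolynomial (Fin 2) K}
    (hh : Irreducible h) (hg : ∀ p, eval p h = 0 → eval p g = 0) : h ∣ g := by
  have hprime : (Ideal.span {h}).IsPrime :=
    (Ideal.span_singleton_prime hh.ne_zero).mpr hh.prime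
  rw [← Ideal.mem_span_singleton, ← IsPrime.vanishingIdeal_zeroLocus (K := K) (Ideal.span {h})]
  intro p hp
  rw [aeval_eq_eval]
  refine hg p ?_
  have := hp h (Ideal.mem_span_singleton_self h)
  rwa [aeval_eq_eval] at this

/-- An irreducible curve of fixed points of an involution reversing a regular automorphism contains
infinitely many periodic points of the latter. -/
theorem IsRegularWith.infinite_periodicPts [CharZero K] [IsAlgClosed K]
    {φ s : MvPolynomial (Fin 2) K ≃ₐ[K] MvPolynomial (Fin 2) K} {d : ℕ} {p₀ : Fin 2 → K}
    {H : MvPolynomial (Fin 2) K} (hφ : IsRegularWith φ d p₀ H)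
    {f σ : Equiv.Perm (Fin 2 → K)} (hf : ∀ p a, eval p (φ a) = eval (f p) a)
    (hσ : ∀ p a, eval p (s a) = eval (σ p) a) (hσσ : σ * σ = 1) (hrev : σ * f * σ * f = 1)
    {h : MvPolynomial (Fin 2) K} (hh : Irreducible h) (hfix : ∀ p, eval p h = 0 → σ p = p) :
    ({p | eval p h = 0} ∩ Function.periodicPts f).Infinite := by
  have : Infinite K := IsAlgClosed.instInfinite
  have hs : s * s = 1 := by
    ext1 a
    refine MvPolynomial.funext fun p => ?_
    change eval p (s (s a)) = eval p a
    rw [hσ, hσ, ← Equiv.Perm.mul_apply, hσσ, Equiv.Perm.one_apply]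
  have hrev' : φ * s * φ * s = 1 := by
    ext1 a
    refine MvPolynomial.funext fun p => ?_
    change eval p (φ (s (φ (s a)))) = eval p a
    rw [hf, hσ, hf, hσ]
    exact congrArg (fun x => eval x a) (DFunLike.congr_fun hrev p)
  have hrev'' : s * φ * s * φ = 1 := by
    have h1 : φ * (s * φ * s) = 1 := by rw [← mul_assoc, ← mul_assoc]; exact hrev'
    exact mul_eq_one_comm.mp h1
  have hfn : ∀ n p a, eval p ((φ ^ n) a) = eval ((f ^ n) p) a := by
    intro n
    induction n with
    | zero => intro p a; rfl
    | succ n ih =>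
      intro p a
      rw [pow_succ' φ, pow_succ f]
      change eval p (φ ((φ ^ n) a)) = eval ((f ^ n) (f p)) a
      rw [hf, ih]
  have hsfix : ∀ p, eval p h = 0 → FixesPoint s p := fun p hp a => by rw [hσ, hfix p hp]
  have hper : ∀ n, n ≠ 0 → ¬ h ∣ (φ ^ n) h := fun n hn => hφ.not_dvd_pow hh hn
  have hs1 : s ≠ 1 := by
    rintro rfl
    simp only [one_mul, mul_one] at hrev''
    refine hper 2 two_ne_zero ?_
    rw [pow_two, hrev'']
    exact dvd_rfl
  have hsmooth : ∀ p, eval p h = 0 → gradientAt p h ≠ 0 := by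
    intro p hp h0
    apply hs1
    refine eq_one_of_jacobianAt_eq_one (hsfix p hp) hs ?_
    have hX : ∀ i, gradientAt p (s (X i)) = gradientAt p (X i) := by
      intro i
      obtain ⟨k, hk⟩ := dvd_of_forall_eval_eq_zero hh (g := s (X i) - X i) fun x hx => by
        rw [map_sub, hsfix x hx, sub_self]
      rw [← sub_eq_zero, ← map_sub, hk, gradientAt_mul, h0, hp, smul_zero, zero_smul, add_zero]
    rw [← jacobianAt_one p]
    ext j i
    exact congrFun (hX i) j
  obtain ⟨c, hc⟩ : ∃ c, s h = C c * h := by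
    obtain ⟨k, hk⟩ := dvd_of_forall_eval_eq_zero hh (g := s h) fun x hx => by
      rw [hsfix x hx, hx]
    have hunit : IsUnit k :=
      ((algEquiv_irreducible s hh).isUnit_or_isUnit hk).resolve_left hh.not_isUnit
    have hdeg := (isUnit_iff_totalDegree_of_isReduced.mp hunit).2
    rw [totalDegree_eq_zero_iff_eq_C] at hdeg
    exact ⟨_, by rw [hk, mul_comm, ← hdeg]⟩
  -- A point of the curve with an image on the curve is periodic.
  have hperiodic : ∀ p n, n ≠ 0 → eval p h = 0 → eval p ((φ ^ n) h) = 0 →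
      p ∈ Function.periodicPts f := by
    intro p n hn hp hpn
    rw [hfn] at hpn
    have h1 := DFunLike.congr_fun (mul_pow_mul_pow_eq_one hσσ hrev n) p
    simp only [Equiv.Perm.mul_apply, Equiv.Perm.one_apply] at h1
    rw [hfix _ hpn] at h1
    have h2 : (f ^ n) ((f ^ n) p) = p := by
      apply σ.injective
      rw [h1, hfix p hp]
    refine ⟨n + n, by omega, ?_⟩
    rw [Function.IsPeriodicPt, Function.IsFixedPt, ← Equiv.Perm.coe_pow, pow_add]
    exact h2
  intro hfin
  set S := hfin.toFinset with hS
  have hSh : ∀ p ∈ S, eval p h = 0 := fun p hp => (hfin.mem_toFinset.mp hp).1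
  have hloc : ∀ p : Fin 2 → K, ∃ N, N ≠ 0 ∧ (p ∈ S → ∀ N', N' ≠ 0 → N ∣ N' → ∃ M,
      ∀ᶠ n in Filter.atTop, ∃ t, eval p t ≠ 0 ∧
      ∀ q, eval p q = 0 → t * q ^ M ∈ Ideal.span {h, (φ ^ (N' * n)) h}) := by
    intro p
    by_cases hp : p ∈ S
    · obtain ⟨m, hm, hmp⟩ := (hfin.mem_toFinset.mp hp).2
      have hfixp : FixesPoint (φ ^ m) p := fun a => by
        rw [hfn, Equiv.Perm.coe_pow, hmp]
      obtain ⟨N, hN, hN'⟩ := exists_forall_dvd_eventually hm.ne' hfixp (hsfix p (hSh p hp)) hs hrev''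
        hh (hSh p hp) hc (hsmooth p (hSh p hp)) hper
      exact ⟨N, hN, fun _ => hN'⟩
    · exact ⟨1, one_ne_zero, fun h => absurd h hp⟩
  choose Np hNp0 hNp using hloc
  set N := ∏ p ∈ S, Np p with hN
  have hN0 : N ≠ 0 := Finset.prod_ne_zero_iff.mpr fun p _ => hNp0 p
  have hmult : ∀ p : Fin 2 → K, ∃ M, p ∈ S → ∀ᶠ n in Filter.atTop, ∃ t, eval p t ≠ 0 ∧
      ∀ q, eval p q = 0 → t * q ^ M ∈ Ideal.span {h, (φ ^ (N * n)) h} := by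
    intro p
    by_cases hp : p ∈ S
    · obtain ⟨M, hM⟩ := hNp p hp N hN0 (Finset.dvd_prod_of_mem Np hp)
      exact ⟨M, fun _ => hM⟩
    · exact ⟨0, fun h => absurd h hp⟩
  choose Mp hMp using hmult
  set M := ∑ p ∈ S, Mp p with hM
  -- A function `q` vanishing at all periodic points of the curve, but not on the curve.
  have hlin : ∀ p : Fin 2 → K, ∃ l, eval p l = 0 ∧ (p ∈ S → ¬ h ∣ l) := by
    intro p
    by_cases hp : p ∈ S
    · by_contra! hall
      have hg : ∀ i : Fin 2, ∃ k : K, (Pi.single i 1 : Fin 2 → K) = k • gradientAt p h := by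
        intro i
        obtain ⟨-, k, hk⟩ := hall (X i - C (p i)) (by simp)
        refine ⟨eval p k, ?_⟩
        have h1 := congrArg (gradientAt p) hk
        rw [gradientAt_mul, hSh p hp, zero_smul, add_zero] at h1
        rw [← h1, map_sub, gradientAt_C, sub_zero, gradientAt_X]
      obtain ⟨k₀, hk₀⟩ := hg 0
      obtain ⟨k₁, hk₁⟩ := hg 1
      have e00 := congrFun hk₀ 0
      have e01 := congrFun hk₀ 1
      have e11 := congrFun hk₁ 1
      simp at e00 e01 e11
      rcases e01 with e | e
      · rw [e, zero_mul] at e00; exact one_ne_zero e00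
      · rw [e, mul_zero] at e11; exact one_ne_zero e11
    · exact ⟨0, by simp, fun h => absurd h hp⟩
  choose l hlp hlh using hlin
  set q := ∏ p ∈ S, l p with hq
  have hqS : ∀ p ∈ S, eval p q = 0 := fun p hp => by
    rw [hq, map_prod]
    exact Finset.prod_eq_zero hp (hlp p)
  have hqh : ¬ h ∣ q ^ M := fun hdvd => by
    obtain ⟨p, hp, hpl⟩ := (hh.prime.dvd_finsetProd_iff _).mp (hh.prime.dvd_of_dvd_pow hdvd)
    exact hlh p hp hpl
  obtain ⟨n₀, hn₀⟩ := hφ.exists_forall_notMem_span_pair hh hqh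
  have hev : ∀ᶠ n in Filter.atTop, ∀ p ∈ S, ∃ t, eval p t ≠ 0 ∧
      ∀ q, eval p q = 0 → t * q ^ Mp p ∈ Ideal.span {h, (φ ^ (N * n)) h} :=
    (Filter.eventually_all_finset S).mpr fun p hp => hMp p hp
  obtain ⟨n, hn, hnn₀, hn0⟩ := (hev.and ((Filter.eventually_ge_atTop n₀).and
    (Filter.eventually_ne_atTop 0))).exists
  refine hn₀ (N * n) (hnn₀.trans (Nat.le_mul_of_pos_left n (Nat.pos_of_ne_zero hN0))) ?_
  -- Membership is checked at each maximal ideal, through the ideal of multipliers of `q ^ M`.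
  set J := Ideal.span {h, (φ ^ (N * n)) h} with hJ
  let I : Ideal (MvPolynomial (Fin 2) K) :=
    Submodule.comap (LinearMap.toSpanSingleton (MvPolynomial (Fin 2) K) _ (q ^ M)) J
  have hI : ∀ x, x ∈ I ↔ x * q ^ M ∈ J := fun x => Iff.rfl
  suffices hItop : I = ⊤ by
    have h1 : (1 : MvPolynomial (Fin 2) K) ∈ I := by rw [hItop]; trivial
    rwa [hI, one_mul] at h1
  by_contra hItop
  obtain ⟨m, hm, hIm⟩ := Ideal.exists_le_maximal I hItop
  obtain ⟨x, rfl⟩ := isMaximal_iff_eq_vanishingIdeal_singleton.mp hm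
  have hvan : ∀ a, a ∈ I → eval x a = 0 := fun a ha => by
    have := (mem_vanishingIdeal_singleton_iff (k := K) x a).mp (hIm ha)
    rwa [aeval_eq_eval] at this
  have hxh : eval x h = 0 := hvan h ((hI h).mpr
    (Ideal.mul_mem_right _ _ (Ideal.subset_span (by simp))))
  have hxn : eval x ((φ ^ (N * n)) h) = 0 := hvan _ ((hI _).mpr
    (Ideal.mul_mem_right _ _ (Ideal.subset_span (by simp))))
  have hxS : x ∈ S := hfin.mem_toFinset.mpr
    ⟨hxh, hperiodic x _ (mul_ne_zero hN0 hn0) hxh hxn⟩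
  obtain ⟨t, ht, htq⟩ := hn x hxS
  refine ht (hvan t ((hI t).mpr ?_))
  obtain ⟨k, hk⟩ := Nat.exists_eq_add_of_le (Finset.single_le_sum (f := Mp)
    (fun _ _ => Nat.zero_le _) hxS)
  rw [hM, hk, pow_add, ← mul_assoc]
  exact Ideal.mul_mem_right _ _ (htq q (hqS x hxS))

/-! ### Polynomial automorphisms of the plane -/

/-- The action of a polynomial automorphism of the plane on polynomials. -/
theorem exists_algEquiv_of_polyAut [Infinite K] (g : PolyAut K) :
    ∃ φ : MvPolynomial (Fin 2) K ≃ₐ[K] MvPolynomial (Fin 2) K,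
      ∀ p a, eval p (φ a) = eval ((g : Equiv.Perm (Fin 2 → K)) p) a := by
  obtain ⟨g, ⟨P, hP⟩, ⟨Q, hQ⟩⟩ := g
  have hev : ∀ {g : (Fin 2 → K) → Fin 2 → K} {P}, HasComponents g P → ∀ p a,
      eval p (aeval P a) = eval (g p) a := by
    intro g P hP p a
    have : g p = fun i => eval p (P i) := funext (hP p)
    rw [this, ← aeval_eq_eval, ← AlgHom.comp_apply, ← aeval_eq_eval]
    congr 1
    ext i; simp [aeval_eq_eval]
  refine ⟨AlgEquiv.ofAlgHom (aeval P) (aeval Q) ?_ ?_, fun p a => hev hP p a⟩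
  · refine AlgHom.ext fun a => MvPolynomial.funext fun p => ?_
    rw [AlgHom.comp_apply, hev hP, hev hQ]
    simp
  · refine AlgHom.ext fun a => MvPolynomial.funext fun p => ?_
    rw [AlgHom.comp_apply, hev hQ, hev hP]
    simp

theorem eval_homogenizeTo_of_eq_zero (d : ℕ) (Q : MvPolynomial (Fin 2) K) {q : Fin 3 → K}
    (hq : q 2 = 0) : eval q (homogenizeTo d Q) =
      eval (fun i => q i.castSucc) (homogeneousComponent d Q) := by
  rw [homogenizeTo, map_sum, Finset.sum_eq_single d]
  · rw [map_mul, Nat.sub_self, pow_zero, map_one, mul_one, eval_rename]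
    rfl
  · intro k hk hkd
    have := Finset.mem_range.mp hk
    rw [map_mul, map_pow, eval_X, hq, zero_pow (by omega), mul_zero]
  · simp

theorem IsRegularAut.exists_isRegularWith [Infinite K] {f : PolyAut K} (hf : IsRegularAut f)
    {φ : MvPolynomial (Fin 2) K ≃ₐ[K] MvPolynomial (Fin 2) K}
    (hφ : ∀ p a, eval p (φ a) = eval ((f : Equiv.Perm (Fin 2 → K)) p) a) :
    ∃ d p H, IsRegularWith φ d p H := by
  obtain ⟨P, hP, hd, pp, hpp, hdef, hcon⟩ := hf
  have hφX : ∀ i, φ (X i) = P i := fun i => MvPolynomial.funext fun p => by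
    rw [hφ, eval_X, hP p i]
  set d := mapDegree P with hdP
  have hle : ∀ i, (P i).totalDegree ≤ d := by
    intro i; fin_cases i
    · exact le_max_left _ _
    · exact le_max_right _ _
  have htop : ∃ i, homogeneousComponent d (P i) ≠ 0 := by
    have : ∃ i, d = (P i).totalDegree := by
      rcases le_total (P 0).totalDegree (P 1).totalDegree with h | h
      · exact ⟨1, max_eq_right h⟩
      · exact ⟨0, max_eq_left h⟩
    obtain ⟨i, hi⟩ := this
    refine ⟨i, ?_⟩
    rw [hi]
    refine homogeneousComponent_totalDegree_ne_zero fun h0 => ?_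
    rw [h0, totalDegree_zero] at hi
    omega
  have hproj : ∀ q : Fin 3 → K, q 2 = 0 → ∀ i : Fin 2, projExtension P q i.castSucc =
      eval (fun i => q i.castSucc) (homogeneousComponent d (P i)) := by
    intro q hq i
    fin_cases i <;> exact eval_homogenizeTo_of_eq_zero _ _ hq
  have hproj2 : ∀ q : Fin 3 → K, q 2 = 0 → projExtension P q 2 = 0 := by
    intro q hq
    change q 2 ^ mapDegree P = 0
    rw [hq, zero_pow (by omega)]
  have hlineq : ∀ q : Fin 2 → K, ∃ c, (∀ i : Fin 2,
      eval q (homogeneousComponent d (P i)) = c * pp i.castSucc) ∧ c * pp 2 = 0 := by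
    intro q
    obtain ⟨c, hc⟩ := hcon ![q 0, q 1, 0] rfl
    refine ⟨c, fun i => ?_, ?_⟩
    · have h1 := hproj ![q 0, q 1, 0] rfl i
      rw [hc] at h1
      have h2 : (fun i : Fin 2 => (![q 0, q 1, 0] : Fin 3 → K) i.castSucc) = q := by
        ext i; fin_cases i <;> rfl
      rw [h2] at h1
      exact h1.symm
    · have h1 := hproj2 ![q 0, q 1, 0] rfl
      rw [hc] at h1
      exact h1
  have hpp2 : pp 2 = 0 := by
    by_contra h2
    obtain ⟨i, hi⟩ := htop
    refine hi (MvPolynomial.funext fun q => ?_)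
    obtain ⟨c, hc, hc2⟩ := hlineq q
    rw [hc i, (mul_eq_zero.mp hc2).resolve_right h2, zero_mul, map_zero]
  obtain ⟨i, hi⟩ : ∃ i : Fin 2, pp i.castSucc ≠ 0 := by
    by_contra! h0
    refine hpp (funext fun j => ?_)
    fin_cases j
    · exact h0 0
    · exact h0 1
    · exact hpp2
  have htops : ∀ j, homogeneousComponent d (P j) =
      C (pp j.castSucc) * (C (pp i.castSucc)⁻¹ * homogeneousComponent d (P i)) := by
    intro j
    refine MvPolynomial.funext fun q => ?_
    obtain ⟨c, hc, -⟩ := hlineq q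
    rw [map_mul, map_mul, eval_C, eval_C, hc, hc]
    field_simp
  have hpH : eval (fun k : Fin 2 => pp k.castSucc)
      (C (pp i.castSucc)⁻¹ * homogeneousComponent d (P i)) ≠ 0 := by
    intro h0
    refine hdef (funext fun j => ?_)
    have h1 : ∀ j : Fin 2, projExtension P pp j.castSucc = 0 := fun j => by
      rw [hproj pp hpp2, htops j, map_mul, h0, mul_zero]
    fin_cases j
    · exact h1 0
    · exact h1 1
    · exact hproj2 pp hpp2
  exact ⟨d, fun k => pp k.castSucc, C (pp i.castSucc)⁻¹ * homogeneousComponent d (P i),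
    { ne_zero := fun h => hi (congrFun h i)
      form_ne_zero := fun h => hpH (by rw [h, map_zero])
      isHomogeneous := (homogeneousComponent_isHomogeneous _ _).C_mul _
      totalDegree_le := fun j => by rw [hφX]; exact hle j
      homogeneousComponent_eq := fun j => by rw [hφX]; exact htops j
      two_le := hd
      eval_ne_zero := hpH }⟩

theorem mainTheorem11 {K : Type*} [Field K] [CharZero K] [IsAlgClosed K]
    (f σ : PolyAut K) (hf : IsHenonType f)
    (hσ : σ * σ = 1) (hrev : σ⁻¹ * f * σ = f⁻¹)
    (C : Set (Fin 2 → K)) (hC : IsPlaneCurve C)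
    (hfix : C ⊆ Function.fixedPoints (σ : Equiv.Perm (Fin 2 → K))) :
    (C ∩ Function.periodicPts (f : Equiv.Perm (Fin 2 → K))).Infinite := by
  have : Infinite K := IsAlgClosed.instInfinite
  obtain ⟨P, hPdeg, rfl⟩ := hC
  obtain ⟨g, hreg⟩ := hf
  have hP0 : P ≠ 0 := by rintro rfl; simp at hPdeg
  have hPunit : ¬ IsUnit P := fun h => hPdeg (isUnit_iff_totalDegree_of_isReduced.mp h).2
  obtain ⟨h, hh, hhP⟩ := WfDvdMonoid.exists_irreducible_factor hPunit hP0
  obtain ⟨γ, hγ⟩ := exists_algEquiv_of_polyAut g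
  obtain ⟨φ, hφ⟩ := exists_algEquiv_of_polyAut (g⁻¹ * f * g)
  obtain ⟨s, hs⟩ := exists_algEquiv_of_polyAut (g⁻¹ * σ * g)
  obtain ⟨d, p₀, H, hφreg⟩ := hreg.exists_isRegularWith hφ
  have hσinv : σ⁻¹ = σ := inv_eq_of_mul_eq_one_left hσ
  have hσσ : (g⁻¹ * σ * g) * (g⁻¹ * σ * g) = 1 := by
    rw [show (g⁻¹ * σ * g) * (g⁻¹ * σ * g) = g⁻¹ * (σ * σ) * g by group, hσ]
    group
  have hrev' : (g⁻¹ * σ * g) * (g⁻¹ * f * g) * (g⁻¹ * σ * g) * (g⁻¹ * f * g) = 1 := by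
    rw [show (g⁻¹ * σ * g) * (g⁻¹ * f * g) * (g⁻¹ * σ * g) * (g⁻¹ * f * g) =
      g⁻¹ * (σ * f * σ * f) * g by group]
    rw [hσinv] at hrev
    rw [hrev, inv_mul_cancel]
    group
  have hcurve : ∀ p, eval p (γ h) = 0 → eval ((g : Equiv.Perm (Fin 2 → K)) p) P = 0 := by
    intro p hp
    obtain ⟨k, rfl⟩ := hhP
    rw [hγ] at hp
    rw [map_mul, hp, zero_mul]
  have hinf := hφreg.infinite_periodicPts hφ hs
    (congrArg (fun x : PolyAut K => (x : Equiv.Perm (Fin 2 → K))) hσσ)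
    (congrArg (fun x : PolyAut K => (x : Equiv.Perm (Fin 2 → K))) hrev')
    (algEquiv_irreducible γ hh) fun p hp => by
      have h1 : (σ : Equiv.Perm (Fin 2 → K)) ((g : Equiv.Perm (Fin 2 → K)) p) =
        (g : Equiv.Perm (Fin 2 → K)) p := hfix (hcurve p hp)
      change (g : Equiv.Perm (Fin 2 → K)).symm
        ((σ : Equiv.Perm (Fin 2 → K)) ((g : Equiv.Perm (Fin 2 → K)) p)) = p
      rw [h1, Equiv.symm_apply_apply]
  refine (hinf.image (g : Equiv.Perm (Fin 2 → K)).injective.injOn).mono ?_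
  rintro _ ⟨p, ⟨hp, n, hn, hnp⟩, rfl⟩
  refine ⟨hcurve p hp, n, hn, ?_⟩
  refine hnp.map (g := (g : Equiv.Perm (Fin 2 → K))) fun x => ?_
  change (g : Equiv.Perm (Fin 2 → K)) ((g : Equiv.Perm (Fin 2 → K)).symm
    ((f : Equiv.Perm (Fin 2 → K)) ((g : Equiv.Perm (Fin 2 → K)) x))) = _
  rw [Equiv.apply_symm_apply]
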